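/- **Lemma 4.4.** For $\tau\in\mathbb H=\{\operatorname{Im}\tau>0\}$ put $q=e^{2\pi i\tau}$, $\theta_{00}(\tau)=\sum_{n\in\mathbb Z}e^{\pi i n^2\tau}$, $\theta_{01}(\tau)=\sum_{n\in\mathbb Z}(-1)^n e^{\pi i n^2\tau}$, and $$h_1=4(\theta_{00}^4+\theta_{01}^4),\qquad h_2=\tfrac14(\theta_{00}^4-\theta_{01}^4)^2 .$$ Let $E_4=1+240\sum_{n\ge1}\sigma_3(n)q^n$ and $E_6=1-504\sum_{n\ge1}\sigma_5(n)q^n$ be the normalized Eisenstein series and $\eta(\tau)=e^{2\pi i\tau/24}\prod_{n\ge1}(1-q^n)$ the Dedekind eta function. For $a,b\ge1$ let $\mathbb P(a,b)=(\mathbb C^2\setminus\{0\})/\mathbb C^\times$ for the action $\lambda\cdot(x,y)=(\lambda^ax,\lambda^by)$. Then $h_1$ and $h_2$ are modular forms of weight $2$ and $4$ for $\Gamma_0(2)\subset \mathrm{SL}_2(\mathbb Z)$, and the following hold. 1. For all $\tau\in\mathbb H$, $$h_1(\tau)^2-48h_2(\tau)=64E_4(2\tau)=64\Big(1+240\sum_{n\ge1}\sigma_3(n)q^{2n}\Big),$$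 $$h_1(\tau)\big(h_1(\tau)^2-72h_2(\tau)\big)=512E_6(2\tau)=512\Big(1-504\sum_{n\ge1}\sigma_5(n)q^{2n}\Big),$$ $$h_2(\tau)^2\big(h_1(\tau)^2-64h_2(\tau)\big)=2^{18}\eta(2\tau)^{24}=2^{18}q^2\prod_{n\ge1}(1-q^{2n})^{24},$$ $$h_1(\tau)^2-64h_2(\tau)\ne0,\qquad \frac{h_2(\tau)}{h_1(\tau)^2-64h_2(\tau)}=\frac{\eta(2\tau)^{24}}{\eta(\tau)^{24}} .$$ 2. $h_1$ and $h_2$ have no common zero on $\mathbb H$, and in $\mathbb P(2,4)$ $$\lim_{t\to\infty}[h_1(it):h_2(it)]=[1:0],\qquad \lim_{t\to\infty}\big[h_1(-\tfrac1{2it}):h_2(-\tfrac1{2it})\big]=[8:1].$$ 3. The map $\tau\mapsto[h_1(\tau):h_2(\tau)]$, extended by $\infty\mapsto[1:0]$ and $0\mapsto[8:1]$, is an isomorphism $$\mathbb H/\Gamma_0(2)\cup\{0,\infty\}\;\cong\;\mathbb P(1,2)$$ of complex analytic spaces, where the left side is the modular curve compactified by its two cusps. 4. For $u=(u_1,u_2)\in\mathbb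 C^2$ let $E(u)$ be the curve $Y^2=X^4+X^3+(-u_2+\frac{u_1}2+\frac14)X^2+\frac{u_1}4X+\frac{u_1^2}{16}$. Let $g_2(u)$, $g_3(u)$ be the classical invariants of the quartic on the right, i.e. $g_2=ae-4bd+3c^2$ and $g_3=\det\begin{pmatrix}a&b&c\\b&c&d\\c&d&e\end{pmatrix}$ for $aX^4+4bX^3+6cX^2+4dX+e$, and let $\Delta_E(u)=g_2(u)^3-27g_3(u)^2$. If $\Delta_E(u)\ne0$, then $$[h_1(\tau):h_2(\tau)]=[1-4u_1-4u_2:u_1u_2]\quad\text{in }\mathbb P(1,2)$$ for some $\tau\in\mathbb H$, and for every such $\tau$ there is $\omega\in\mathbb C^\times$ such that the lattice $\Lambda=\mathbb Z\omega+\mathbb Z\,2\tau\omega$ has $g_2(\Lambda)=g_2(u)$ and $g_3(\Lambda)=g_3(u)$. Conversely, for every $\tau\in\mathbb H$ this equality of points holds for some $u$ with $\Delta_E(u)\ne0$. -/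

import Mathlib

open UpperHalfPlane

noncomputable section

namespace ThetaLevelTwo

/-! ### Theta constants and the forms `h₁`, `h₂` -/

/-- The theta constant `θ_{xy}(τ) = ∑_{n ∈ ℤ} exp(πi (n + a)² τ + 2πi (n + a) b)` of one variable
with `a = x / 2` and `b = y / 2`. -/
def theta (x y : ℤ) (τ : ℍ) : ℂ :=
  ∑' n : ℤ, Complex.exp (Real.pi * Complex.I * ((n : ℂ) + x / 2) ^ 2 * (τ : ℂ)
    + 2 * Real.pi * Complex.I * ((n : ℂ) + x / 2) * (y / 2))

/-- `h₁ = 4 (θ₀₀⁴ + θ₀₁⁴)`. -/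
def h₁ (τ : ℍ) : ℂ := 4 * (theta 0 0 τ ^ 4 + theta 0 1 τ ^ 4)

/-- `h₂ = (θ₀₀⁴ - θ₀₁⁴)² / 4`. -/
def h₂ (τ : ℍ) : ℂ := (theta 0 0 τ ^ 4 - theta 0 1 τ ^ 4) ^ 2 / 4

/-- The point `2τ` of the upper half plane. -/
def twice (τ : ℍ) : ℍ := ⟨2 * (τ : ℂ), by simpa using τ.im_pos⟩

/-- `q = exp(2πiτ)`. -/
def nome (τ : ℍ) : ℂ := Complex.exp (2 * Real.pi * Complex.I * (τ : ℂ))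

/-! ### Weighted projective lines -/

/-- Two nonzero vectors of `ℂ²` are equivalent if they differ by the action
`λ • (x, y) = (λ ^ a x, λ ^ b y)` of some `λ ∈ ℂˣ`. -/
def weightedSetoid (a b : ℕ) : Setoid {v : ℂ × ℂ // v ≠ 0} where
  r v w := ∃ l : ℂˣ, (w : ℂ × ℂ) = ((l : ℂ) ^ a * (v : ℂ × ℂ).1, (l : ℂ) ^ b * (v : ℂ × ℂ).2)
  iseqv :=
    { refl := fun v => ⟨1, by simp⟩
      symm := by
        rintro v w ⟨l, hl⟩
        refine ⟨l⁻¹, ?_⟩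
        rw [hl]
        simp
      trans := by
        rintro u v w ⟨l, hl⟩ ⟨m, hm⟩
        refine ⟨m * l, ?_⟩
        rw [hm, hl]
        simp [mul_assoc, mul_pow] }

/-- The weighted projective line `ℙ(a, b) = (ℂ² ∖ {0}) / ℂˣ`. -/
def WProj (a b : ℕ) : Type := Quotient (weightedSetoid a b)

namespace WProj

/-- The point `[x : y]` of `ℙ(a, b)`. -/
def mk (a b : ℕ) (v : ℂ × ℂ) (hv : v ≠ 0) : WProj a b :=
  Quotient.mk (weightedSetoid a b) ⟨v, hv⟩

/-- `ℙ(a, b)` carries the quotient topology. -/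
instance (a b : ℕ) : TopologicalSpace (WProj a b) :=
  inferInstanceAs (TopologicalSpace (Quotient (weightedSetoid a b)))

open Classical in
/-- The pullback to `ℂ² ∖ {0}` of a function on `ℙ(a, b)`, with the irrelevant value `0` at the
origin. -/
def pullback {a b : ℕ} (f : WProj a b → ℂ) (v : ℂ × ℂ) : ℂ :=
  if hv : v ≠ 0 then f (mk a b v hv) else 0

/-- The structure sheaf of the complex analytic space `ℙ(a, b)`: a function on an open set `U` is
holomorphic if its pullback to the preimage of `U` in `ℂ² ∖ {0}` is holomorphic. -/
def HolomorphicOn {a b : ℕ} (U : Set (WProj a b)) (f : WProj a b → ℂ) : Prop :=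
  DifferentiableOn ℂ (pullback f) {v | ∃ hv : v ≠ 0, mk a b v hv ∈ U}

end WProj

/-! ### The compactified modular curve of level `Γ₀(2)` -/

/-- The set `ℍ / Γ₀(2) ∪ {0, ∞}`. -/
inductive ModularCurve : Type
  | ofOrbit (p : MulAction.orbitRel.Quotient (CongruenceSubgroup.Gamma0 2) ℍ)
  | zero
  | infty

namespace ModularCurve

/-- The projection `ℍ → ℍ / Γ₀(2)`. -/
def proj (τ : ℍ) : ModularCurve := ofOrbit (Quotient.mk _ τ)

/-- The usual topology: `U` is open if its preimage in `ℍ` is open and contains a horoball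
`Im τ > c` if `∞ ∈ U` and a horoball `Im (-1/τ) > c` if `0 ∈ U`. -/
instance : TopologicalSpace ModularCurve where
  IsOpen U := IsOpen {τ : ℍ | proj τ ∈ U} ∧
    (infty ∈ U → ∃ c : ℝ, ∀ τ : ℍ, c < τ.im → proj τ ∈ U) ∧
    (zero ∈ U → ∃ c : ℝ, ∀ τ : ℍ, c < (ModularGroup.S • τ).im → proj τ ∈ U)
  isOpen_univ := by simp
  isOpen_inter := by
    rintro U V ⟨hU, hU₁, hU₀⟩ ⟨hV, hV₁, hV₀⟩
    refine ⟨hU.inter hV, fun h => ?_, fun h => ?_⟩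
    · obtain ⟨c, hc⟩ := hU₁ h.1
      obtain ⟨d, hd⟩ := hV₁ h.2
      exact ⟨max c d, fun τ hτ => ⟨hc τ ((le_max_left c d).trans_lt hτ),
        hd τ ((le_max_right c d).trans_lt hτ)⟩⟩
    · obtain ⟨c, hc⟩ := hU₀ h.1
      obtain ⟨d, hd⟩ := hV₀ h.2
      exact ⟨max c d, fun τ hτ => ⟨hc τ ((le_max_left c d).trans_lt hτ),
        hd τ ((le_max_right c d).trans_lt hτ)⟩⟩
  isOpen_sUnion := by
    intro s hs
    refine ⟨?_, ?_, ?_⟩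
    · have : {τ : ℍ | proj τ ∈ ⋃₀ s} = ⋃ U ∈ s, {τ : ℍ | proj τ ∈ U} := by
        ext τ
        simp
      rw [this]
      exact isOpen_biUnion fun U hU => (hs U hU).1
    · rintro ⟨U, hU, h⟩
      obtain ⟨c, hc⟩ := (hs U hU).2.1 h
      exact ⟨c, fun τ hτ => ⟨U, hU, hc τ hτ⟩⟩
    · rintro ⟨U, hU, h⟩
      obtain ⟨c, hc⟩ := (hs U hU).2.2 h
      exact ⟨c, fun τ hτ => ⟨U, hU, hc τ hτ⟩⟩

open scoped Manifold in
/-- The structure sheaf of the compact Riemann surface `ℍ / Γ₀(2) ∪ {0, ∞}`: a function on an open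
set `U` is holomorphic if it is continuous on `U` and its pullback to the preimage of `U` in `ℍ`
is holomorphic. (By Riemann's theorem on removable singularities, continuity at a cusp is the same
as holomorphy in the local parameter, which is `exp(2πiτ)` at `∞` and `exp(-πi/τ)` at `0`.) -/
def HolomorphicOn (U : Set ModularCurve) (f : ModularCurve → ℂ) : Prop :=
  ContinuousOn f U ∧
    MDifferentiableOn 𝓘(ℂ) 𝓘(ℂ) (fun τ : ℍ => f (proj τ)) {τ : ℍ | proj τ ∈ U}

end ModularCurve

/-! ### The family of elliptic curves -/

/-- The invariant `g₂ = ae - 4bd + 3c²` of `aX⁴ + 4bX³ + 6cX² + 4dX + e`. -/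
def quarticG₂ (a b c d e : ℂ) : ℂ := a * e - 4 * b * d + 3 * c ^ 2

/-- The invariant `g₃` of `aX⁴ + 4bX³ + 6cX² + 4dX + e`. -/
def quarticG₃ (a b c d e : ℂ) : ℂ := Matrix.det !![a, b, c; b, c, d; c, d, e]

/-- The invariant `g₂` of the curve `E(u)`, which is
`Y² = X⁴ + X³ + (-u₂ + u₁/2 + 1/4) X² + (u₁/4) X + u₁²/16`. -/
def g₂ (u₁ u₂ : ℂ) : ℂ :=
  quarticG₂ 1 (1 / 4) ((-u₂ + u₁ / 2 + 1 / 4) / 6) (u₁ / 4 / 4) (u₁ ^ 2 / 16)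

/-- The invariant `g₃` of the curve `E(u)`. -/
def g₃ (u₁ u₂ : ℂ) : ℂ :=
  quarticG₃ 1 (1 / 4) ((-u₂ + u₁ / 2 + 1 / 4) / 6) (u₁ / 4 / 4) (u₁ ^ 2 / 16)

/-- The discriminant `Δ_E = g₂³ - 27 g₃²` of the curve `E(u)`. -/
def discE (u₁ u₂ : ℂ) : ℂ := g₂ u₁ u₂ ^ 3 - 27 * g₃ u₁ u₂ ^ 2

end ThetaLevelTwo

end

noncomputable section

namespace ThetaLevelTwo

open Complex Filter Topology ModularForm
open scoped Real Manifold MatrixGroups ComplexConjugate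

/-! ### Theta constants -/

/-! The identities come from level one. `S` and `T` permute the fourth powers of the three theta
constants up to signs and a factor `τ²`, and there is no nonzero cusp form of level one and weight
below 12 (`levelOne_eq_zero`). This yields Jacobi's relation and expresses `E₄`, `E₆` and `Δ`
through theta constants. The doubling formulas `theta_zero_zero_sq` and `theta_zero_one_sq` then
turn `h₁`, `h₂` into polynomials in theta constants at `2τ`, and part 1 becomes polynomial algebra.
Modularity for `Γ₀(2)` holds because `SL₂(ℤ)` permutes three conjugates of each form, and `Γ₀(2)`
fixes the one in question.

The isomorphism rests on the single function `w = h₂ / (h₁² - 64 h₂) = Δ(2τ)/Δ(τ)`. It has no zero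
on `ℍ`, behaves like `q` at `∞`, and tends to infinity at the cusp `0`. Hence it is proper modulo
`Γ₀(2)` as a map to `ℂ ∖ {0}`. Openness and properness give surjectivity (`exists_hauptmodul_eq`).
For injectivity, the set of values taken on two different orbits is open, and closed away from `0`
and the countably many critical values. The complement of a countable set in the plane is connected,
and values near `0` are taken on only one orbit, so the set is empty (`multipleValues_eq_empty`).

In `ℙ(1, 2)` only `[x² : y]` matters, so `w` and `1/w` are affine coordinates there. A continuous
bijection from a compact space to a Hausdorff space is a homeomorphism. Holomorphic functions
correspond by the chain rule in one direction, and in the other by local inverses of `w` together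
with removability of countable sets (`holomorphicOn_iff`).

For the curves, `g₂(u)`, `g₃(u)` and the discriminant are, up to constants, the polynomials of part
1 evaluated at `(1 - 4u₁ - 4u₂, u₁u₂)`. The period is a rescaling that absorbs the projective
factor. -/

lemma theta_zero_zero (τ : ℍ) : theta 0 0 τ = jacobiTheta₂ 0 τ := by
  simp only [theta, jacobiTheta₂, jacobiTheta₂_term]
  refine tsum_congr fun n => ?_
  push_cast; ring_nf

lemma theta_zero_one (τ : ℍ) : theta 0 1 τ = jacobiTheta₂ (1 / 2) τ := by
  simp only [theta, jacobiTheta₂, jacobiTheta₂_term]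
  refine tsum_congr fun n => ?_
  push_cast; ring_nf

lemma theta_one_zero (τ : ℍ) :
    theta 1 0 τ = cexp (π * Complex.I * τ / 4) * jacobiTheta₂ (τ / 2) τ := by
  simp only [theta, jacobiTheta₂, jacobiTheta₂_term, ← tsum_mul_left, ← Complex.exp_add]
  refine tsum_congr fun n => ?_
  push_cast; ring_nf

lemma mdifferentiable_theta_zero_zero : MDiff (theta 0 0) := by
  rw [UpperHalfPlane.mdifferentiable_iff]
  have h : DifferentiableOn ℂ (fun z : ℂ => jacobiTheta₂ 0 z) {z | 0 < z.im} := fun z hz =>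
    (differentiableAt_jacobiTheta₂_snd 0 hz).differentiableWithinAt
  refine h.congr fun z hz => ?_
  simp [theta_zero_zero, ofComplex_apply_of_im_pos hz]

lemma mdifferentiable_theta_zero_one : MDiff (theta 0 1) := by
  rw [UpperHalfPlane.mdifferentiable_iff]
  have h : DifferentiableOn ℂ (fun z : ℂ => jacobiTheta₂ (1 / 2) z) {z | 0 < z.im} := fun z hz =>
    (differentiableAt_jacobiTheta₂_snd _ hz).differentiableWithinAt
  refine h.congr fun z hz => ?_
  simp [theta_zero_one, ofComplex_apply_of_im_pos hz]

lemma mdifferentiable_theta_one_zero : MDiff (theta 1 0) := by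
  rw [UpperHalfPlane.mdifferentiable_iff]
  have h : DifferentiableOn ℂ (fun z : ℂ => cexp (π * Complex.I * z / 4) * jacobiTheta₂ (z / 2) z)
      {z | 0 < z.im} := fun z hz => by
    refine DifferentiableAt.differentiableWithinAt (.mul (by fun_prop) ?_)
    exact (hasFDerivAt_jacobiTheta₂ (z / 2) hz).differentiableAt.comp z
      (f := fun z : ℂ => (z / 2, z)) (by fun_prop)
  refine h.congr fun z hz => ?_
  simp [theta_one_zero, ofComplex_apply_of_im_pos hz]

/-! ### Transformation of the theta constants under `T` and `S` -/

lemma exp_pi_mul_I_mul_int (n : ℤ) : cexp (π * Complex.I * n) = (-1) ^ n := by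
  rw [mul_comm, exp_int_mul, exp_pi_mul_I]

lemma coe_T_smul (τ : ℍ) : ((ModularGroup.T • τ : ℍ) : ℂ) = τ + 1 := by
  rw [modular_T_smul, coe_vadd, add_comm]; simp

lemma coe_S_smul (τ : ℍ) : ((ModularGroup.S • τ : ℍ) : ℂ) = -1 / τ := by
  rw [modular_S_smul, coe_mk, inv_neg, neg_div, one_div]

/-- Since `n² ≡ n` modulo 2, the factor `exp(πi n²)` produced by the translation is `(-1)ⁿ`. -/
lemma theta_zero_zero_T (τ : ℍ) : theta 0 0 (ModularGroup.T • τ) = theta 0 1 τ := by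
  simp only [theta, coe_T_smul]
  refine tsum_congr fun n => ?_
  obtain ⟨k, hk⟩ := Int.even_mul_pred_self n
  have hk' : (n : ℂ) * (n - 1) = k + k := by exact_mod_cast hk
  refine Complex.exp_eq_exp_iff_exists_int.2 ⟨k, ?_⟩
  push_cast
  linear_combination π * Complex.I * hk'

lemma theta_zero_one_T (τ : ℍ) : theta 0 1 (ModularGroup.T • τ) = theta 0 0 τ := by
  simp only [theta, coe_T_smul]
  refine tsum_congr fun n => ?_
  obtain ⟨k, hk⟩ := Int.even_mul_succ_self n
  have hk' : (n : ℂ) * (n + 1) = k + k := by exact_mod_cast hk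
  refine Complex.exp_eq_exp_iff_exists_int.2 ⟨k, ?_⟩
  push_cast
  linear_combination π * Complex.I * hk'

lemma theta_one_zero_T (τ : ℍ) :
    theta 1 0 (ModularGroup.T • τ) = cexp (π * Complex.I / 4) * theta 1 0 τ := by
  simp only [theta, coe_T_smul, ← tsum_mul_left, ← Complex.exp_add]
  refine tsum_congr fun n => ?_
  obtain ⟨k, hk⟩ := Int.even_mul_succ_self n
  have hk' : (n : ℂ) * (n + 1) = k + k := by exact_mod_cast hk
  refine Complex.exp_eq_exp_iff_exists_int.2 ⟨k, ?_⟩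
  push_cast
  linear_combination π * Complex.I * hk'

lemma theta_one_zero_T_pow_four (τ : ℍ) :
    theta 1 0 (ModularGroup.T • τ) ^ 4 = -theta 1 0 τ ^ 4 := by
  rw [theta_one_zero_T, mul_pow, ← Complex.exp_nat_mul]
  have : ((4 : ℕ) : ℂ) * (π * Complex.I / 4) = π * Complex.I := by push_cast; ring
  rw [this, exp_pi_mul_I]; ring

lemma cpow_half_sq (z : ℂ) : (z ^ (1 / 2 : ℂ)) ^ 2 = z := by
  rw [one_div]; exact_mod_cast cpow_nat_inv_pow z two_ne_zero

lemma cpow_half_pow_four {z : ℂ} : (z ^ (1 / 2 : ℂ)) ^ 4 = z ^ 2 := by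
  rw [show 4 = 2 * 2 from rfl, pow_mul, cpow_half_sq]

/-- The functional equation carries a factor `(-iτ)^(1/2)`; the fourth power removes the choice of
branch and leaves `(-iτ)² = -τ²`. -/
lemma theta_zero_zero_S_pow_four (τ : ℍ) :
    theta 0 0 (ModularGroup.S • τ) ^ 4 = -(τ : ℂ) ^ 2 * theta 0 0 τ ^ 4 := by
  have h := jacobiTheta₂_functional_equation 0 τ
  rw [theta_zero_zero, theta_zero_zero, h, coe_S_smul, mul_pow, mul_pow, div_pow,
    cpow_half_pow_four]
  have := τ.ne_zero
  simp [mul_pow]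
  field_simp

lemma theta_one_zero_S_pow_four (τ : ℍ) :
    theta 1 0 (ModularGroup.S • τ) ^ 4 = -(τ : ℂ) ^ 2 * theta 0 1 τ ^ 4 := by
  have h := jacobiTheta₂_functional_equation (1 / 2) τ
  have h0 := τ.ne_zero
  rw [theta_one_zero, theta_zero_one, h, coe_S_smul]
  have e1 : (-1 / (τ : ℂ)) / 2 = -(1 / 2 / τ) := by ring
  have e2 : -(π : ℂ) * Complex.I * (1 / 2) ^ 2 / τ = π * Complex.I * (-1 / τ) / 4 := by ring
  rw [e1, jacobiTheta₂_neg_left, e2]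
  simp only [mul_pow, div_pow, cpow_half_pow_four]
  simp
  field_simp

lemma theta_zero_one_S_pow_four (τ : ℍ) :
    theta 0 1 (ModularGroup.S • τ) ^ 4 = -(τ : ℂ) ^ 2 * theta 1 0 τ ^ 4 := by
  have h := theta_one_zero_S_pow_four (ModularGroup.S • τ)
  have h0 := τ.ne_zero
  have e : ModularGroup.S • ModularGroup.S • τ = τ := by
    ext; rw [coe_S_smul, coe_S_smul]; field_simp
  rw [e, coe_S_smul] at h
  rw [h]; field_simp

/-! ### Doubling -/

lemma coe_twice (τ : ℍ) : (twice τ : ℂ) = 2 * τ := rfl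

lemma summable_theta_term (x : ℤ) (τ : ℍ) :
    Summable fun n : ℤ => cexp (π * Complex.I * ((n : ℂ) + x / 2) ^ 2 * τ) := by
  have h := ((summable_jacobiTheta₂_term_iff (x * τ / 2) τ).2 τ.im_pos).mul_left
    (cexp (π * Complex.I * x ^ 2 * τ / 4))
  refine h.congr fun n => ?_
  rw [jacobiTheta₂_term, ← Complex.exp_add]
  ring_nf

lemma theta_left_sq (x : ℤ) (τ : ℍ) : theta x 0 τ ^ 2 = ∑' p : ℤ × ℤ,
    cexp (π * Complex.I * (((p.1 : ℂ) + x / 2) ^ 2 + ((p.2 : ℂ) + x / 2) ^ 2) * τ) := by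
  have hs := (summable_theta_term x τ).norm
  have h : theta x 0 τ = ∑' n : ℤ, cexp (π * Complex.I * ((n : ℂ) + x / 2) ^ 2 * τ) := by
    simp [theta]
  rw [h, sq, tsum_mul_tsum_of_summable_norm hs hs]
  refine tsum_congr fun p => ?_
  rw [← Complex.exp_add]; ring_nf

lemma summable_theta_sq (x : ℤ) (τ : ℍ) : Summable fun p : ℤ × ℤ =>
    cexp (π * Complex.I * (((p.1 : ℂ) + x / 2) ^ 2 + ((p.2 : ℂ) + x / 2) ^ 2) * τ) := by
  have hs := (summable_theta_term x τ).norm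
  refine (summable_mul_of_summable_norm hs hs).congr fun p => ?_
  rw [← Complex.exp_add]; ring_nf

/-- Pairs of integers of equal, respectively different, parity are `(u + v, u - v)`, respectively
`(u + v + 1, u - v)`. -/
def parityEquiv : (ℤ × ℤ) ⊕ (ℤ × ℤ) ≃ ℤ × ℤ where
  toFun := Sum.elim (fun p => (p.1 + p.2, p.1 - p.2)) (fun p => (p.1 + p.2 + 1, p.1 - p.2))
  invFun p := if (p.1 + p.2) % 2 = 0 then .inl ((p.1 + p.2) / 2, (p.1 - p.2) / 2)
    else .inr ((p.1 + p.2 - 1) / 2, (p.1 - p.2 - 1) / 2)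
  left_inv := by
    rintro (⟨u, v⟩ | ⟨u, v⟩)
    · have h : (u + v + (u - v)) % 2 = 0 := by omega
      simp only [Sum.elim_inl, h, if_true]
      congr 2 <;> omega
    · have h : ¬ (u + v + 1 + (u - v)) % 2 = 0 := by omega
      simp only [Sum.elim_inr, h, if_false]
      congr 2 <;> omega
  right_inv := by
    rintro ⟨m, n⟩
    by_cases h : (m + n) % 2 = 0
    · simp only [h, if_true, Sum.elim_inl]
      ext <;> simp only <;> omega
    · simp only [h, if_false, Sum.elim_inr]
      ext <;> simp only <;> omega

/-- Split the double sum over `(m, n)` by the parity of `m + n`. With `m = a + b`, `n = a - b` one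
has `m² + n² = 2(a² + b²)`, where `a`, `b` are both integers or both half-integers. -/
lemma theta_zero_zero_sq (τ : ℍ) :
    theta 0 0 τ ^ 2 = theta 0 0 (twice τ) ^ 2 + theta 1 0 (twice τ) ^ 2 := by
  rw [theta_left_sq, theta_left_sq, theta_left_sq, ← parityEquiv.tsum_eq]
  have h0 := summable_theta_sq 0 (twice τ)
  have h1 := summable_theta_sq 1 (twice τ)
  refine HasSum.tsum_eq (HasSum.sum ?_ ?_)
  · convert h0.hasSum using 2 with p
    simp [parityEquiv, coe_twice]; ring_nf
  · convert h1.hasSum using 2 with p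
    simp [parityEquiv, coe_twice]; ring_nf

lemma twice_T_smul (τ : ℍ) :
    twice (ModularGroup.T • τ) = ModularGroup.T • ModularGroup.T • twice τ := by
  ext; simp only [coe_twice, coe_T_smul]; ring

lemma theta_zero_one_sq (τ : ℍ) :
    theta 0 1 τ ^ 2 = theta 0 0 (twice τ) ^ 2 - theta 1 0 (twice τ) ^ 2 := by
  rw [← theta_zero_zero_T, theta_zero_zero_sq, twice_T_smul, theta_zero_zero_T, theta_zero_one_T,
    theta_one_zero_T, theta_one_zero_T, ← mul_assoc, ← Complex.exp_add, mul_pow,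
    ← Complex.exp_nat_mul]
  have : ((2 : ℕ) : ℂ) * (π * Complex.I / 4 + π * Complex.I / 4) = π * Complex.I := by
    push_cast; ring
  rw [this, exp_pi_mul_I]; ring

/-! ### Behaviour at `i∞` -/

lemma eventually_atImInfty_im_gt (c : ℝ) : ∀ᶠ τ : ℍ in atImInfty, c < τ.im :=
  tendsto_comap.eventually (eventually_gt_atTop c)

/-- A power of `q` times a theta constant, summed over `ℤ`, tends to the sum of its constant terms
at `i∞`. -/
lemma tendsto_tsum_exp_atImInfty (e : ℤ → ℤ) (he : ∀ n, 0 ≤ e n) (he' : ∀ n, |n| ≤ e n + 1)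
    (a : ℤ → ℂ) (ha : ∀ n, ‖a n‖ = 1) :
    Tendsto (fun τ : ℍ => ∑' n : ℤ, a n * cexp (π * Complex.I * e n * τ)) atImInfty
      (𝓝 (∑' n : ℤ, if e n = 0 then a n else 0)) := by
  have hnorm (n : ℤ) (τ : ℍ) : ‖a n * cexp (π * Complex.I * e n * τ)‖
      = Real.exp (-(π * e n * τ.im)) := by
    rw [norm_mul, ha, one_mul, Complex.norm_exp]
    congr 1
    rw [show (π : ℂ) * Complex.I * e n * τ = ((π * e n : ℝ) : ℂ) * τ * Complex.I by
      push_cast; ring, Complex.mul_I_re, Complex.im_ofReal_mul]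
    rfl
  -- For `Im τ > 1`, each term has norm at most `exp(-π e n) ≤ exp(π - π|n|)`, by the growth
  -- hypothesis on `e`.
  refine tendsto_tsum_of_dominated_convergence
    (bound := fun n : ℤ => Real.exp π * Real.exp (-(π * |n|))) ?_ ?_ ?_
  · refine Summable.mul_left _ ?_
    have h : Summable fun n : ℕ => Real.exp (-(π * n)) := by
      have := Real.summable_exp_nat_mul_iff (a := -π) |>.2 (by linarith [Real.pi_pos])
      exact this.congr fun n => by ring_nf
    refine Summable.of_nat_of_neg ?_ ?_ <;> simpa using h
  · intro n
    rcases eq_or_ne (e n) 0 with h | h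
    · simp [h]
    · simp only [h, if_false]
      rw [tendsto_zero_iff_norm_tendsto_zero]
      simp only [hnorm]
      have hpos : (0 : ℝ) < π * e n := by
        have := lt_of_le_of_ne (he n) (Ne.symm h)
        have : (0 : ℝ) < e n := by exact_mod_cast this
        exact mul_pos Real.pi_pos this
      exact Real.tendsto_exp_neg_atTop_nhds_zero.comp
        ((tendsto_const_mul_atTop_of_pos hpos).2 tendsto_comap)
  · filter_upwards [eventually_atImInfty_im_gt 1] with τ hτ n
    rw [hnorm, ← Real.exp_add, Real.exp_le_exp]
    have h1 : (|n| : ℝ) ≤ e n + 1 := by exact_mod_cast he' n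
    have h2 : (0 : ℝ) ≤ e n := by exact_mod_cast he n
    have h3 : (e n : ℝ) ≤ e n * τ.im := le_mul_of_one_le_right h2 hτ.le
    have := mul_le_mul_of_nonneg_left (h1.trans (add_le_add_left h3 1)) Real.pi_pos.le
    push_cast
    linarith

lemma abs_le_sq_add_one (n : ℤ) : |n| ≤ n ^ 2 + 1 := by
  rw [← sq_abs]; nlinarith [abs_nonneg n]

lemma tendsto_theta_zero_zero : Tendsto (theta 0 0) atImInfty (𝓝 1) := by
  have h := tendsto_tsum_exp_atImInfty (fun n => n ^ 2) (fun n => sq_nonneg n) abs_le_sq_add_one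
    (fun _ => 1) (fun _ => by simp)
  convert h using 2 with τ
  · simp [theta]
  · simp

lemma tendsto_theta_zero_one : Tendsto (theta 0 1) atImInfty (𝓝 1) := by
  have h := tendsto_tsum_exp_atImInfty (fun n => n ^ 2) (fun n => sq_nonneg n) abs_le_sq_add_one
    (fun n => cexp (π * Complex.I * n)) (fun n => by simp [exp_pi_mul_I_mul_int])
  convert h using 2 with τ
  · simp only [theta, ← Complex.exp_add]
    refine tsum_congr fun n => ?_
    push_cast; ring_nf
  · simp only [sq_eq_zero_iff]
    rw [tsum_ite_eq]; simp

lemma tendsto_theta_one_zero_mul_exp :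
    Tendsto (fun τ : ℍ => theta 1 0 τ * cexp (-(π * Complex.I * τ / 4))) atImInfty (𝓝 2) := by
  have h := tendsto_tsum_exp_atImInfty (fun n => n ^ 2 + n) (fun n => ?_) (fun n => ?_)
    (fun _ => 1) (fun _ => by simp)
  · convert h using 2 with τ
    · simp only [theta, ← tsum_mul_right, ← Complex.exp_add]
      refine tsum_congr fun n => ?_
      push_cast; rw [one_mul]; ring_nf
    -- The exponent `n² + n` vanishes at both `0` and `-1`, whence the limit 2.
    · have : (fun n : ℤ => if n ^ 2 + n = 0 then (1 : ℂ) else 0)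
          = fun n => if n ∈ ({0, -1} : Finset ℤ) then 1 else 0 := by
        ext n
        have : n ^ 2 + n = 0 ↔ n = 0 ∨ n = -1 := by
          rw [show n ^ 2 + n = n * (n + 1) by ring, mul_eq_zero, add_eq_zero_iff_eq_neg]
        simp [this]
      rw [this, tsum_eq_sum (s := {0, -1}) (fun b hb => by simp [hb])]
      rw [Finset.sum_pair (by decide)]; norm_num
  · have := Int.even_mul_succ_self n
    rcases le_or_gt 0 n with h | h <;> nlinarith
  · rcases le_or_gt 0 n with h | h
    · rw [abs_of_nonneg h]; nlinarith
    · rw [abs_of_neg h]; nlinarith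

lemma tendsto_theta_one_zero : Tendsto (theta 1 0) atImInfty (𝓝 0) := by
  have h : Tendsto (fun τ : ℍ => cexp (π * Complex.I * τ / 4)) atImInfty (𝓝 0) := by
    rw [tendsto_zero_iff_norm_tendsto_zero]
    have : ∀ τ : ℍ, ‖cexp (π * Complex.I * τ / 4)‖ = Real.exp (-(π / 4 * τ.im)) := fun τ => by
      rw [Complex.norm_exp, show (π : ℂ) * Complex.I * τ / 4 = ((π / 4 : ℝ) : ℂ) * τ * Complex.I by
        push_cast; ring, Complex.mul_I_re, Complex.im_ofReal_mul]
      rfl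
    simp only [this]
    exact Real.tendsto_exp_neg_atTop_nhds_zero.comp
      ((tendsto_const_mul_atTop_of_pos (by positivity)).2 tendsto_comap)
  have := tendsto_theta_one_zero_mul_exp.mul h
  rw [mul_zero] at this
  refine this.congr fun τ => ?_
  rw [mul_assoc, ← Complex.exp_add]; simp

/-! ### Level one identities -/

/-- A holomorphic form of level one and weight less than 12 that vanishes at `i∞` is zero. -/
lemma levelOne_eq_zero {k : ℤ} (hk : k < 12) {f : ℍ → ℂ} (hf : MDiff f)
    (hS : f ∣[k] ModularGroup.S = f) (hT : f ∣[k] ModularGroup.T = f)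
    (h0 : Tendsto f atImInfty (𝓝 0)) : f = 0 := by
  let F : CuspForm 𝒮ℒ k :=
    { toFun := f
      slash_action_eq' := by
        rintro A ⟨A, rfl⟩
        exact SlashInvariantForm.slash_action_generators_SL2Z hS hT A
      holo' := hf
      zero_at_cusps' := fun hc => by
        rw [OnePoint.isZeroAt_iff_forall_SL2Z hc]
        intro γ _
        rw [SlashInvariantForm.slash_action_generators_SL2Z hS hT]
        exact h0 }
  have hr := CuspForm.rank_eq_zero_of_weight_lt_twelve hk
  rw [rank_zero_iff] at hr
  have : F = 0 := Subsingleton.elim _ _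
  exact congrArg (fun G : CuspForm 𝒮ℒ k => (G : ℍ → ℂ)) this

lemma slash_S_eq_iff {k : ℤ} {f g : ℍ → ℂ} :
    f ∣[k] ModularGroup.S = g ↔ ∀ τ : ℍ, f (ModularGroup.S • τ) = (τ : ℂ) ^ k * g τ := by
  rw [funext_iff]
  refine forall_congr' fun τ => ?_
  rw [SL_slash_apply, ModularGroup.denom_S, zpow_neg, ← div_eq_mul_inv,
    div_eq_iff (zpow_ne_zero _ τ.ne_zero), mul_comm]

lemma slash_T_eq_iff {k : ℤ} {f g : ℍ → ℂ} :
    f ∣[k] ModularGroup.T = g ↔ ∀ τ : ℍ, f (ModularGroup.T • τ) = g τ := by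
  rw [funext_iff]
  refine forall_congr' fun τ => ?_
  have : denom (ModularGroup.T : GL (Fin 2) ℝ) τ = 1 := by
    simp [ModularGroup.denom_apply, ModularGroup.coe_T]
  rw [SL_slash_apply, this]; simp

/-- The difference of the two sides changes sign under `T` and is multiplied by `-τ²` under `S`, so
it is its square that is a form of level one, of weight 4, and it vanishes at `i∞`. -/
lemma theta_jacobi (τ : ℍ) : theta 0 0 τ ^ 4 = theta 0 1 τ ^ 4 + theta 1 0 τ ^ 4 := by
  have h := levelOne_eq_zero (k := 4) (by norm_num)
    (f := fun τ => (theta 0 0 τ ^ 4 - theta 0 1 τ ^ 4 - theta 1 0 τ ^ 4) ^ 2)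
    ?_ ?_ ?_ ?_
  · have := congrFun h τ
    simp only [Pi.zero_apply, sq_eq_zero_iff] at this
    linear_combination this
  · exact ((((mdifferentiable_theta_zero_zero.pow 4).sub (mdifferentiable_theta_zero_one.pow 4)).sub
      (mdifferentiable_theta_one_zero.pow 4)).pow 2)
  · rw [slash_S_eq_iff]
    intro τ
    simp only [theta_zero_zero_S_pow_four, theta_zero_one_S_pow_four, theta_one_zero_S_pow_four]
    norm_cast; ring
  · rw [slash_T_eq_iff]
    intro τ
    simp only [theta_zero_zero_T, theta_zero_one_T, theta_one_zero_T_pow_four]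
    ring
  · have := (((tendsto_theta_zero_zero.pow 4).sub (tendsto_theta_zero_one.pow 4)).sub
      (tendsto_theta_one_zero.pow 4)).pow 2
    simpa using this

lemma tendsto_E {k : ℕ} (hk : 3 ≤ k) (hk2 : Even k) : Tendsto (E hk) atImInfty (𝓝 1) := by
  have hanal := ModularFormClass.analyticAt_cuspFunction_zero (E hk) one_pos
    one_mem_strictPeriods_SL
  have h0 := EisensteinSeries.E_qExpansion_coeff_zero hk hk2
  rw [qExpansion_coeff_zero one_pos hanal
    (SlashInvariantFormClass.periodic_comp_ofComplex (E hk) one_mem_strictPeriods_SL),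
    ← cuspFunction_apply_zero one_pos hanal
    (SlashInvariantFormClass.periodic_comp_ofComplex (E hk) one_mem_strictPeriods_SL)] at h0
  rw [← h0]
  exact (hanal.continuousAt.tendsto.comp (qParam_tendsto_atImInfty one_pos)).congr
      (fun τ => SlashInvariantFormClass.eq_cuspFunction (E hk) τ one_mem_strictPeriods_SL
        one_ne_zero)

lemma E_slash {k : ℕ} (hk : 3 ≤ k) (γ : SL(2, ℤ)) : (E hk : ℍ → ℂ) ∣[(k : ℤ)] γ = E hk :=
  (E hk).slash_action_eq' _ ⟨γ, rfl⟩

/-- The right side is symmetric in the squares of the fourth powers, so signs and permutations do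
not affect it; both sides tend to 1 at `i∞`. -/
lemma E₄_eq_theta (τ : ℍ) :
    E₄ τ = (theta 0 0 τ ^ 8 + theta 0 1 τ ^ 8 + theta 1 0 τ ^ 8) / 2 := by
  have hE := E_slash (by norm_num : 3 ≤ 4)
  have h := levelOne_eq_zero (k := 4) (by norm_num)
    (f := fun τ => E₄ τ - ((theta 0 0 τ ^ 4) ^ 2 + (theta 0 1 τ ^ 4) ^ 2 +
      (theta 1 0 τ ^ 4) ^ 2) * 2⁻¹) ?_ ?_ ?_ ?_
  · have := congrFun h τ
    simp only [Pi.zero_apply] at this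
    linear_combination this
  · exact E₄.holo'.sub (((((mdifferentiable_theta_zero_zero.pow 4).pow 2).add
      ((mdifferentiable_theta_zero_one.pow 4).pow 2)).add
      ((mdifferentiable_theta_one_zero.pow 4).pow 2)).mul mdifferentiable_const)
  · rw [slash_S_eq_iff]
    intro τ
    have := slash_S_eq_iff.1 (hE ModularGroup.S) τ
    simp only [theta_zero_zero_S_pow_four, theta_zero_one_S_pow_four, theta_one_zero_S_pow_four,
      this]
    norm_cast; ring
  · rw [slash_T_eq_iff]
    intro τ
    have := slash_T_eq_iff.1 (hE ModularGroup.T) τ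
    simp only [theta_zero_zero_T, theta_zero_one_T, theta_one_zero_T_pow_four, this]
    ring
  · have := (tendsto_E (by norm_num : 3 ≤ 4) ⟨2, rfl⟩).sub
      (((((tendsto_theta_zero_zero.pow 4).pow 2).add ((tendsto_theta_zero_one.pow 4).pow 2)).add
      ((tendsto_theta_one_zero.pow 4).pow 2)).mul_const 2⁻¹)
    convert this using 2
    norm_num

/-- The three factors are permuted up to sign by `S` and `T`. Under `S` the sign of the last factor
cancels that of `(-τ²)³`. -/
lemma E₆_eq_theta (τ : ℍ) :
    E₆ τ = (theta 0 0 τ ^ 4 + theta 0 1 τ ^ 4) * (theta 0 0 τ ^ 4 + theta 1 0 τ ^ 4) *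
      (theta 0 1 τ ^ 4 - theta 1 0 τ ^ 4) / 2 := by
  have hE := E_slash (by norm_num : 3 ≤ 6)
  have h := levelOne_eq_zero (k := 6) (by norm_num)
    (f := fun τ => E₆ τ -
      (theta 0 0 τ ^ 4 + theta 0 1 τ ^ 4) * (theta 0 0 τ ^ 4 + theta 1 0 τ ^ 4) *
      (theta 0 1 τ ^ 4 - theta 1 0 τ ^ 4) * 2⁻¹) ?_ ?_ ?_ ?_
  · have := congrFun h τ
    simp only [Pi.zero_apply] at this
    linear_combination this
  · have ha := mdifferentiable_theta_zero_zero.pow 4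
    have hb := mdifferentiable_theta_zero_one.pow 4
    have hc := mdifferentiable_theta_one_zero.pow 4
    exact E₆.holo'.sub ((((ha.add hb).mul (ha.add hc)).mul (hb.sub hc)).mul mdifferentiable_const)
  · rw [slash_S_eq_iff]
    intro τ
    have := slash_S_eq_iff.1 (hE ModularGroup.S) τ
    simp only [theta_zero_zero_S_pow_four, theta_zero_one_S_pow_four, theta_one_zero_S_pow_four,
      this]
    norm_cast; ring
  · rw [slash_T_eq_iff]
    intro τ
    have := slash_T_eq_iff.1 (hE ModularGroup.T) τ
    simp only [theta_zero_zero_T, theta_zero_one_T, theta_one_zero_T_pow_four, this]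
    ring
  · have ha := tendsto_theta_zero_zero.pow 4
    have hb := tendsto_theta_zero_one.pow 4
    have hc := tendsto_theta_one_zero.pow 4
    have := (tendsto_E (by norm_num : 3 ≤ 6) ⟨3, rfl⟩).sub
      ((((ha.add hb).mul (ha.add hc)).mul (hb.sub hc)).mul_const 2⁻¹)
    convert this using 2
    norm_num

lemma discriminant_eq_theta (τ : ℍ) :
    2 ^ 8 * discriminant τ = (theta 0 0 τ * theta 0 1 τ * theta 1 0 τ) ^ 8 := by
  rw [discriminant_eq_E₄_cube_sub_E₆_sq, E₄_eq_theta, E₆_eq_theta]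
  have h := theta_jacobi τ
  generalize theta 0 0 τ = x at *
  generalize theta 0 1 τ = y at *
  generalize theta 1 0 τ = z at *
  simp only [show ∀ w : ℂ, w ^ 8 = (w ^ 4) ^ 2 from fun w => by ring, mul_pow]
  rw [h]
  ring

/-! ### The forms `h₁` and `h₂` -/

lemma h₂_eq (τ : ℍ) : h₂ τ = theta 1 0 τ ^ 8 / 4 := by
  rw [h₂, theta_jacobi]; ring

lemma h₁_sq_sub (τ : ℍ) :
    h₁ τ ^ 2 - 64 * h₂ τ = 64 * (theta 0 0 τ ^ 4 * theta 0 1 τ ^ 4) := by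
  rw [h₁, h₂]; ring

lemma theta_pow_four_twice (τ : ℍ) :
    theta 0 0 τ ^ 4 = (theta 0 0 (twice τ) ^ 2 + theta 1 0 (twice τ) ^ 2) ^ 2 ∧
    theta 0 1 τ ^ 4 = (theta 0 0 (twice τ) ^ 2 - theta 1 0 (twice τ) ^ 2) ^ 2 := by
  rw [← theta_zero_zero_sq, ← theta_zero_one_sq]
  constructor <;> ring

/-- With `x = θ₀₀(2τ)` and `z = θ₁₀(2τ)`, doubling gives `h₁ = 8(x⁴ + z⁴)` and `h₂ = 4x⁴z⁴`, while
Jacobi's relation at `2τ` eliminates `θ₀₁(2τ)` from `E₄(2τ)`. -/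
lemma h_eq_E₄ (τ : ℍ) : h₁ τ ^ 2 - 48 * h₂ τ = 64 * E₄ (twice τ) := by
  have hJ := theta_jacobi (twice τ)
  rw [E₄_eq_theta, h₁, h₂, (theta_pow_four_twice τ).1, (theta_pow_four_twice τ).2]
  generalize theta 0 0 (twice τ) = x at *
  generalize theta 0 1 (twice τ) = y at *
  generalize theta 1 0 (twice τ) = z at *
  have hy : y ^ 8 = (x ^ 4 - z ^ 4) ^ 2 := by rw [hJ]; ring
  rw [hy]; ring

lemma h_eq_E₆ (τ : ℍ) : h₁ τ * (h₁ τ ^ 2 - 72 * h₂ τ) = 512 * E₆ (twice τ) := by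
  have hJ := theta_jacobi (twice τ)
  rw [E₆_eq_theta, h₁, h₂, (theta_pow_four_twice τ).1, (theta_pow_four_twice τ).2]
  generalize theta 0 0 (twice τ) = x at *
  generalize theta 0 1 (twice τ) = y at *
  generalize theta 1 0 (twice τ) = z at *
  have hy : y ^ 4 = x ^ 4 - z ^ 4 := by rw [hJ]; ring
  rw [hy]; ring

/-- This is `(p - 48q)³ - p(p - 72q)² = 1728 q²(p - 64q)` with `p = h₁²`, `q = h₂`; note `64³ = 512²
= 2¹⁸`. -/
lemma h_eq_discriminant_twice (τ : ℍ) :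
    h₂ τ ^ 2 * (h₁ τ ^ 2 - 64 * h₂ τ) = 2 ^ 18 * discriminant (twice τ) := by
  rw [discriminant_eq_E₄_cube_sub_E₆_sq]
  have h4 := h_eq_E₄ τ
  have h6 := h_eq_E₆ τ
  have e4 : E₄ (twice τ) = (h₁ τ ^ 2 - 48 * h₂ τ) / 64 := by rw [h4]; ring
  have e6 : E₆ (twice τ) = h₁ τ * (h₁ τ ^ 2 - 72 * h₂ τ) / 512 := by rw [h6]; ring
  rw [e4, e6]; ring

/-- Nonvanishing of `Δ` then makes both factors on the left nonzero on `ℍ`. Compared with the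
formula at `2τ`, it also gives the eta quotient. -/
lemma h_eq_discriminant (τ : ℍ) :
    h₂ τ * (h₁ τ ^ 2 - 64 * h₂ τ) ^ 2 = 2 ^ 18 * discriminant τ := by
  have h := discriminant_eq_theta τ
  rw [h₁_sq_sub, h₂_eq]
  linear_combination -(2 ^ 10) * h

lemma h₂_ne_zero (τ : ℍ) : h₂ τ ≠ 0 := by
  intro h
  have := h_eq_discriminant τ
  rw [h, zero_mul, zero_eq_mul] at this
  exact this.elim (by norm_num) (discriminant_ne_zero τ)

lemma h₁_sq_sub_ne_zero (τ : ℍ) : h₁ τ ^ 2 - 64 * h₂ τ ≠ 0 := by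
  intro h
  have := h_eq_discriminant τ
  rw [h, zero_pow two_ne_zero, mul_zero, zero_eq_mul] at this
  exact this.elim (by norm_num) (discriminant_ne_zero τ)

lemma h_ne_zero (τ : ℍ) : (h₁ τ, h₂ τ) ≠ (0 : ℂ × ℂ) := fun h =>
  h₂_ne_zero τ (congrArg Prod.snd h)

lemma mdifferentiable_h₁ : MDiff h₁ :=
  (mdifferentiable_const (c := (4 : ℂ))).mul
    ((mdifferentiable_theta_zero_zero.pow 4).add (mdifferentiable_theta_zero_one.pow 4))

lemma mdifferentiable_h₂ : MDiff h₂ := by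
  have h := (((mdifferentiable_theta_zero_zero.pow 4).sub
    (mdifferentiable_theta_zero_one.pow 4)).pow 2).mul (mdifferentiable_const (c := (4 : ℂ)⁻¹))
  exact h

/-! ### Conjugates under `SL₂(ℤ)` and modularity for `Γ₀(2)` -/

/-- The conjugates of `h₁` under `SL₂(ℤ)`, indexed by the bottom row modulo 2. -/
def conj₁ (v : Fin 2 → ZMod 2) (τ : ℍ) : ℂ :=
  if v 0 = 0 then 4 * (theta 0 0 τ ^ 4 + theta 0 1 τ ^ 4)
  else if v 1 = 0 then -4 * (theta 0 0 τ ^ 4 + theta 1 0 τ ^ 4)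
  else 4 * (theta 1 0 τ ^ 4 - theta 0 1 τ ^ 4)

/-- The conjugates of `h₂` under `SL₂(ℤ)`, indexed by the bottom row modulo 2. -/
def conj₂ (v : Fin 2 → ZMod 2) (τ : ℍ) : ℂ :=
  if v 0 = 0 then (theta 1 0 τ ^ 4) ^ 2 / 4
  else if v 1 = 0 then (theta 0 1 τ ^ 4) ^ 2 / 4
  else (theta 0 0 τ ^ 4) ^ 2 / 4

/-- The right action of `SL₂(ℤ)` on rows modulo 2. -/
def rowMul (v : Fin 2 → ZMod 2) (γ : SL(2, ℤ)) : Fin 2 → ZMod 2 :=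
  ![v 0 * (γ 0 0 : ℤ) + v 1 * (γ 1 0 : ℤ), v 0 * (γ 0 1 : ℤ) + v 1 * (γ 1 1 : ℤ)]

lemma rowMul_mul (v : Fin 2 → ZMod 2) (γ δ : SL(2, ℤ)) :
    rowMul v (γ * δ) = rowMul (rowMul v γ) δ := by
  ext i; fin_cases i <;>
  · simp [rowMul, Matrix.SpecialLinearGroup.coe_mul, Matrix.mul_apply, Fin.sum_univ_two]
    ring

lemma rowMul_one (v : Fin 2 → ZMod 2) : rowMul v 1 = v := by
  ext i; fin_cases i <;> simp [rowMul]

lemma rowMul_ne_zero {v : Fin 2 → ZMod 2} (hv : v ≠ 0) (γ : SL(2, ℤ)) : rowMul v γ ≠ 0 := by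
  intro h
  have h' := rowMul_mul v γ γ⁻¹
  rw [mul_inv_cancel, rowMul_one, h] at h'
  apply hv
  rw [h']
  ext i; fin_cases i <;> simp [rowMul]

/-- A family of functions indexed by the nonzero rows modulo 2 which is permuted by `S` and `T` is
permuted by all of `SL₂(ℤ)`. -/
lemma slash_of_generators {k : ℤ} {f : (Fin 2 → ZMod 2) → ℍ → ℂ}
    (hS : ∀ v ≠ 0, f v ∣[k] ModularGroup.S = f ![v 1, v 0])
    (hT : ∀ v ≠ 0, f v ∣[k] ModularGroup.T = f ![v 0, v 0 + v 1]) (γ : SL(2, ℤ)) :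
    ∀ v ≠ 0, f v ∣[k] γ = f (rowMul v γ) := by
  have hmem : γ ∈ Subgroup.closure {ModularGroup.S, ModularGroup.T} := by
    rw [_root_.SpecialLinearGroup.SL2Z_generators]; trivial
  induction hmem using Subgroup.closure_induction with
  | mem x hx =>
    intro v hv
    rcases hx with rfl | rfl
    · rw [hS v hv]
      congr 1
      ext i; fin_cases i <;> simp [rowMul, ModularGroup.S]
    · rw [hT v hv]
      congr 1
      ext i; fin_cases i <;> simp [rowMul, ModularGroup.T]
  | one => intro v hv; rw [SlashAction.slash_one, rowMul_one]
  | mul x y _ _ hx hy =>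
    intro v hv
    rw [SlashAction.slash_mul, hx v hv, hy _ (rowMul_ne_zero hv x), rowMul_mul]
  | inv x _ hx =>
    intro v hv
    have h := hx _ (rowMul_ne_zero hv x⁻¹)
    rw [← rowMul_mul, inv_mul_cancel, rowMul_one] at h
    rw [← h, ← SlashAction.slash_mul, mul_inv_cancel, SlashAction.slash_one]

lemma zmod_two_vec_cases {v : Fin 2 → ZMod 2} (hv : v ≠ 0) :
    v = ![0, 1] ∨ v = ![1, 0] ∨ v = ![1, 1] := by
  revert v; decide

lemma conj₁_slash_S (v : Fin 2 → ZMod 2) (hv : v ≠ 0) :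
    conj₁ v ∣[(2 : ℤ)] ModularGroup.S = conj₁ ![v 1, v 0] := by
  rw [slash_S_eq_iff]
  intro τ
  rcases zmod_two_vec_cases hv with rfl | rfl | rfl <;>
  · simp [conj₁, -ModularGroup.sl_moeb, theta_zero_zero_S_pow_four, theta_zero_one_S_pow_four,
      theta_one_zero_S_pow_four]
    norm_cast; ring

lemma conj₁_slash_T (v : Fin 2 → ZMod 2) (hv : v ≠ 0) :
    conj₁ v ∣[(2 : ℤ)] ModularGroup.T = conj₁ ![v 0, v 0 + v 1] := by
  rw [slash_T_eq_iff]
  intro τ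
  have h2 : (1 : ZMod 2) + 1 = 0 := rfl
  rcases zmod_two_vec_cases hv with rfl | rfl | rfl <;>
  · simp [conj₁, -ModularGroup.sl_moeb, theta_zero_zero_T, theta_zero_one_T,
      theta_one_zero_T_pow_four, h2]
    ring

lemma conj₂_slash_S (v : Fin 2 → ZMod 2) (hv : v ≠ 0) :
    conj₂ v ∣[(4 : ℤ)] ModularGroup.S = conj₂ ![v 1, v 0] := by
  rw [slash_S_eq_iff]
  intro τ
  rcases zmod_two_vec_cases hv with rfl | rfl | rfl <;>
  · simp [conj₂, -ModularGroup.sl_moeb, theta_zero_zero_S_pow_four, theta_zero_one_S_pow_four,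
      theta_one_zero_S_pow_four]
    norm_cast; ring

lemma conj₂_slash_T (v : Fin 2 → ZMod 2) (hv : v ≠ 0) :
    conj₂ v ∣[(4 : ℤ)] ModularGroup.T = conj₂ ![v 0, v 0 + v 1] := by
  rw [slash_T_eq_iff]
  intro τ
  have h2 : (1 : ZMod 2) + 1 = 0 := rfl
  rcases zmod_two_vec_cases hv with rfl | rfl | rfl <;>
  · simp [conj₂, -ModularGroup.sl_moeb, theta_zero_zero_T, theta_zero_one_T,
      theta_one_zero_T_pow_four, h2]

lemma conj₁_zero_one : conj₁ ![0, 1] = h₁ := by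
  ext τ; simp [conj₁, h₁]

lemma conj₂_zero_one : conj₂ ![0, 1] = h₂ := by
  ext τ; simp [conj₂, h₂_eq, ← pow_mul]

lemma isBoundedAtImInfty_conj₁ (v : Fin 2 → ZMod 2) : IsBoundedAtImInfty (conj₁ v) := by
  have ha := tendsto_theta_zero_zero.pow 4
  have hb := tendsto_theta_zero_one.pow 4
  have hc := tendsto_theta_one_zero.pow 4
  unfold conj₁
  split_ifs
  · exact ((ha.add hb).const_mul 4).isBigO_one ℝ
  · exact ((ha.add hc).const_mul (-4)).isBigO_one ℝ
  · exact ((hc.sub hb).const_mul 4).isBigO_one ℝ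

lemma isBoundedAtImInfty_conj₂ (v : Fin 2 → ZMod 2) : IsBoundedAtImInfty (conj₂ v) := by
  have ha := tendsto_theta_zero_zero.pow 4
  have hb := tendsto_theta_zero_one.pow 4
  have hc := tendsto_theta_one_zero.pow 4
  unfold conj₂
  split_ifs
  · exact ((hc.pow 2).div_const 4).isBigO_one ℝ
  · exact ((hb.pow 2).div_const 4).isBigO_one ℝ
  · exact ((ha.pow 2).div_const 4).isBigO_one ℝ

/-- A modular form for `Γ₀(2)` from a family indexed by rows modulo 2. -/
lemma exists_modularForm {k : ℤ} {f : (Fin 2 → ZMod 2) → ℍ → ℂ}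
    (hS : ∀ v ≠ 0, f v ∣[k] ModularGroup.S = f ![v 1, v 0])
    (hT : ∀ v ≠ 0, f v ∣[k] ModularGroup.T = f ![v 0, v 0 + v 1])
    (hb : ∀ v, IsBoundedAtImInfty (f v)) (hd : MDiff (f ![0, 1])) :
    ∃ F : ModularForm (CongruenceSubgroup.Gamma0 2 : Subgroup (GL (Fin 2) ℝ)) k,
      (F : ℍ → ℂ) = f ![0, 1] := by
  have h01 : (![0, 1] : Fin 2 → ZMod 2) ≠ 0 := by decide
  refine ⟨{ toFun := f ![0, 1], slash_action_eq' := ?_, holo' := hd, bdd_at_cusps' := ?_ }, rfl⟩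
  · rintro A ⟨γ, hγ, rfl⟩
    have h := slash_of_generators hS hT γ _ h01
    have hγ' := CongruenceSubgroup.Gamma0_mem.1 hγ
    have hdet := γ.det_coe
    rw [Matrix.det_fin_two] at hdet
    have hdet' := congrArg (Int.cast : ℤ → ZMod 2) hdet
    push_cast at hdet'
    rw [hγ', mul_zero, sub_zero] at hdet'
    -- An element of `Γ₀(2)` has `ad = 1` modulo 2, so `d = 1` and its bottom row is `(0, 1)`.
    have hv : rowMul ![0, 1] γ = ![0, 1] := by
      have h11 : ((γ 1 1 : ℤ) : ZMod 2) = 1 := by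
        revert hdet'
        generalize ((γ 0 0 : ℤ) : ZMod 2) = x
        generalize ((γ 1 1 : ℤ) : ZMod 2) = y
        revert x y; decide
      ext i; fin_cases i <;> simp [rowMul, hγ', h11]
    rw [hv] at h
    exact h
  · intro c hc
    rw [Subgroup.IsArithmetic.isCusp_iff_isCusp_SL2Z] at hc
    rw [OnePoint.isBoundedAt_iff_forall_SL2Z hc]
    intro γ _
    -- Moving a cusp to `i∞` replaces the function by another member of the family, and all members
    -- are bounded there.
    rw [slash_of_generators hS hT γ _ h01]
    exact hb _

lemma exists_modularForm_h₁ :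
    ∃ F : ModularForm (CongruenceSubgroup.Gamma0 2 : Subgroup (GL (Fin 2) ℝ)) 2,
      (F : ℍ → ℂ) = h₁ := by
  have h := exists_modularForm conj₁_slash_S conj₁_slash_T isBoundedAtImInfty_conj₁
  rw [conj₁_zero_one] at h
  exact h mdifferentiable_h₁

lemma exists_modularForm_h₂ :
    ∃ F : ModularForm (CongruenceSubgroup.Gamma0 2 : Subgroup (GL (Fin 2) ℝ)) 4,
      (F : ℍ → ℂ) = h₂ := by
  have h := exists_modularForm conj₂_slash_S conj₂_slash_T isBoundedAtImInfty_conj₂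
  rw [conj₂_zero_one] at h
  exact h mdifferentiable_h₂

/-! ### Series and products in the nome -/

lemma nome_pow_two_mul (τ : ℍ) (n : ℕ) :
    nome τ ^ (2 * n) = cexp (2 * π * Complex.I * (twice τ : ℂ)) ^ n := by
  rw [nome, pow_mul, coe_twice, ← Complex.exp_nat_mul _ 2]
  push_cast; ring_nf

lemma summable_sigma_nome {k : ℕ} (hk : 1 ≤ k) (τ : ℍ) :
    Summable (fun n : ℕ+ =>
      (ArithmeticFunction.sigma (k - 1) (n : ℕ) : ℂ) * nome τ ^ (2 * (n : ℕ))) := by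
  have h := EisensteinSeries.summable_sigma_mul_cexp_pow hk (twice τ)
  simp only [nome_pow_two_mul]
  exact h.comp_injective PNat.coe_injective

lemma E₄_twice_eq_tsum (τ : ℍ) : E₄ (twice τ) = 1 + 240 * ∑' n : ℕ+,
    (ArithmeticFunction.sigma 3 (n : ℕ) : ℂ) * nome τ ^ (2 * (n : ℕ)) := by
  have hB : bernoulli 4 = -1 / 30 := by
    rw [bernoulli_eq_bernoulli'_of_ne_one (by norm_num), bernoulli'_four]
  rw [EisensteinSeries.q_expansion_bernoulli (by norm_num) ⟨2, rfl⟩, hB]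
  simp only [nome_pow_two_mul]
  norm_num

lemma E₆_twice_eq_tsum (τ : ℍ) : E₆ (twice τ) = 1 - 504 * ∑' n : ℕ+,
    (ArithmeticFunction.sigma 5 (n : ℕ) : ℂ) * nome τ ^ (2 * (n : ℕ)) := by
  have hB : bernoulli 6 = 1 / 42 := by
    decide +kernel
  rw [EisensteinSeries.q_expansion_bernoulli (by norm_num) ⟨3, rfl⟩, hB]
  simp only [nome_pow_two_mul]
  norm_num

lemma norm_nome_lt_one (τ : ℍ) : ‖nome τ‖ < 1 := norm_exp_two_pi_I_lt_one τ

lemma multipliable_nome (τ : ℍ) :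
    Multipliable (fun n : ℕ+ => (1 - nome τ ^ (2 * (n : ℕ))) ^ 24) := by
  have hq : ‖nome τ ^ 2‖ < 1 := by
    rw [norm_pow]; exact pow_lt_one₀ (norm_nonneg _) (norm_nome_lt_one τ) two_ne_zero
  have h := (multipliable_one_sub_pow hq).pow 24
  rw [← multipliable_pnat_iff_multipliable_succ (f := fun n => (1 - (nome τ ^ 2) ^ n) ^ 24)] at h
  simpa only [pow_mul] using h

lemma discriminant_twice_eq_tprod (τ : ℍ) :
    discriminant (twice τ) = nome τ ^ 2 * ∏' n : ℕ+, (1 - nome τ ^ (2 * (n : ℕ))) ^ 24 := by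
  rw [discriminant_eq_q_prod]
  congr 1
  · have := nome_pow_two_mul τ 1
    rw [mul_one, pow_one] at this
    rw [this, Function.Periodic.qParam]
    simp
  · rw [tprod_pnat_eq_tprod_succ (f := fun n => (1 - nome τ ^ (2 * n)) ^ 24)]
    simp only [nome_pow_two_mul, eta_q_eq_pow]

/-! ### The Hauptmodul of `Γ₀(2)` -/

/-- The Hauptmodul `h₂ / (h₁² - 64 h₂) = Δ(2τ) / Δ(τ)`. -/
def hauptmodul (τ : ℍ) : ℂ := h₂ τ / (h₁ τ ^ 2 - 64 * h₂ τ)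

lemma hauptmodul_eq (τ : ℍ) : hauptmodul τ = discriminant (twice τ) / discriminant τ := by
  have h1 := h_eq_discriminant_twice τ
  have h2 := h_eq_discriminant τ
  rw [hauptmodul, div_eq_div_iff (h₁_sq_sub_ne_zero τ) (discriminant_ne_zero τ)]
  have : (2 ^ 18 * (h₁ τ ^ 2 - 64 * h₂ τ) * h₂ τ) ≠ 0 :=
    mul_ne_zero (mul_ne_zero (by norm_num) (h₁_sq_sub_ne_zero τ)) (h₂_ne_zero τ)
  apply mul_left_cancel₀ this
  linear_combination (-(h₁ τ ^ 2 - 64 * h₂ τ) * h₂ τ ^ 2) * h2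
    + ((h₁ τ ^ 2 - 64 * h₂ τ) ^ 2 * h₂ τ) * h1

lemma hauptmodul_ne_zero (τ : ℍ) : hauptmodul τ ≠ 0 :=
  div_ne_zero (h₂_ne_zero τ) (h₁_sq_sub_ne_zero τ)

lemma mdifferentiable_hauptmodul : MDiff hauptmodul := by
  have h1 := UpperHalfPlane.mdifferentiable_iff.1 mdifferentiable_h₁
  have h2 := UpperHalfPlane.mdifferentiable_iff.1 mdifferentiable_h₂
  rw [UpperHalfPlane.mdifferentiable_iff]
  exact h2.div ((h1.pow 2).sub (h2.const_mul 64)) fun z _ => h₁_sq_sub_ne_zero (ofComplex z)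

lemma continuous_hauptmodul : Continuous hauptmodul := mdifferentiable_hauptmodul.continuous

lemma h₁_smul {γ : SL(2, ℤ)} (hγ : γ ∈ CongruenceSubgroup.Gamma0 2) (τ : ℍ) :
    h₁ (γ • τ) = ((γ 1 0 : ℤ) * (τ : ℂ) + (γ 1 1 : ℤ)) ^ 2 * h₁ τ := by
  obtain ⟨F, hF⟩ := exists_modularForm_h₁
  have h := congrFun (F.slash_action_eq' _ ⟨γ, hγ, rfl⟩) τ
  have h' : (F : ℍ → ℂ) (γ • τ) = ((γ 1 0 : ℤ) * (τ : ℂ) + (γ 1 1 : ℤ)) ^ (2 : ℤ) * F τ :=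
    (slash_action_eq'_iff 2 F γ τ).1 h
  rw [hF] at h'
  exact_mod_cast h'

lemma h₂_smul {γ : SL(2, ℤ)} (hγ : γ ∈ CongruenceSubgroup.Gamma0 2) (τ : ℍ) :
    h₂ (γ • τ) = ((γ 1 0 : ℤ) * (τ : ℂ) + (γ 1 1 : ℤ)) ^ 4 * h₂ τ := by
  obtain ⟨F, hF⟩ := exists_modularForm_h₂
  have h := congrFun (F.slash_action_eq' _ ⟨γ, hγ, rfl⟩) τ
  have h' : (F : ℍ → ℂ) (γ • τ) = ((γ 1 0 : ℤ) * (τ : ℂ) + (γ 1 1 : ℤ)) ^ (4 : ℤ) * F τ :=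
    (slash_action_eq'_iff 4 F γ τ).1 h
  rw [hF] at h'
  exact_mod_cast h'

lemma denom_ne_zero' (γ : SL(2, ℤ)) (τ : ℍ) : ((γ 1 0 : ℤ) * (τ : ℂ) + (γ 1 1 : ℤ)) ≠ 0 := by
  have := denom_ne_zero (γ : GL (Fin 2) ℝ) τ
  rwa [ModularGroup.denom_apply] at this

lemma hauptmodul_smul {γ : SL(2, ℤ)} (hγ : γ ∈ CongruenceSubgroup.Gamma0 2) (τ : ℍ) :
    hauptmodul (γ • τ) = hauptmodul τ := by
  have h0 := denom_ne_zero' γ τ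
  rw [hauptmodul, hauptmodul, h₁_smul hγ, h₂_smul hγ]
  rw [show ∀ d : ℂ, (d ^ 2 * h₁ τ) ^ 2 - 64 * (d ^ 4 * h₂ τ) = d ^ 4 * (h₁ τ ^ 2 - 64 * h₂ τ)
    from fun d => by ring, mul_div_mul_left _ _ (pow_ne_zero 4 h0)]

/-- The point `τ / 2` of the upper half plane. -/
def half (τ : ℍ) : ℍ := ⟨(τ : ℂ) / 2, by simpa using τ.im_pos⟩

lemma coe_half (τ : ℍ) : (half τ : ℂ) = τ / 2 := rfl

lemma twice_half (τ : ℍ) : twice (half τ) = τ := by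
  ext; rw [coe_twice, coe_half]; ring

lemma half_im (τ : ℍ) : (half τ).im = τ.im / 2 := by
  rw [← coe_im, coe_half]; simp

lemma twice_S_smul (τ : ℍ) : twice (ModularGroup.S • τ) = ModularGroup.S • half τ := by
  have := τ.ne_zero
  ext; rw [coe_twice, coe_S_smul, coe_S_smul, coe_half]; field_simp

lemma S_smul_S_smul (τ : ℍ) : ModularGroup.S • ModularGroup.S • τ = τ := by
  have := τ.ne_zero
  ext; rw [coe_S_smul, coe_S_smul]; field_simp

/-- Both `Δ(-1/τ)` and `Δ(2·(-1/τ)) = Δ(-1/(τ/2))` transform with weight 12, leaving `2⁻¹²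
Δ(τ/2)/Δ(τ)`. This Fricke-type symmetry reduces the cusp `0` to the cusp `∞`. -/
lemma hauptmodul_S_smul (τ : ℍ) :
    hauptmodul (ModularGroup.S • τ) = (4096 * hauptmodul (half τ))⁻¹ := by
  have hS (σ : ℍ) : discriminant (ModularGroup.S • σ) = (σ : ℂ) ^ 12 * discriminant σ := by
    have := slash_S_eq_iff.1 discriminant_S_invariant σ
    exact_mod_cast this
  have h0 := τ.ne_zero
  have h1 := discriminant_ne_zero τ
  have h2 := discriminant_ne_zero (half τ)
  rw [hauptmodul_eq, hauptmodul_eq, twice_S_smul, hS, hS, twice_half, coe_half]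
  field_simp
  norm_num

/-- The numerator `θ₁₀⁸/4` is asymptotic to `2⁸q/4 = 64q`, and the denominator tends to 64. -/
lemma tendsto_hauptmodul_div_nome :
    Tendsto (fun τ => hauptmodul τ / nome τ) atImInfty (𝓝 1) := by
  have h1 := (tendsto_theta_one_zero_mul_exp.pow 8).div_const 4
  have h2 := ((tendsto_theta_zero_zero.pow 4).mul (tendsto_theta_zero_one.pow 4)).const_mul 64
  have h := h1.div h2 (by norm_num)
  norm_num at h
  refine h.congr fun τ => ?_
  simp only [Pi.div_apply]
  rw [hauptmodul, h₁_sq_sub, h₂_eq, nome, mul_pow, ← Complex.exp_nat_mul]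
  rw [show ((8 : ℕ) : ℂ) * -(π * Complex.I * τ / 4) = -(2 * π * Complex.I * τ) by push_cast; ring,
    Complex.exp_neg]
  ring

lemma qParam_one_eq_nome (τ : ℍ) : Function.Periodic.qParam 1 (τ : ℂ) = nome τ := by
  rw [Function.Periodic.qParam, nome]; simp

lemma nome_ne_zero (τ : ℍ) : nome τ ≠ 0 := Complex.exp_ne_zero _

lemma tendsto_nome : Tendsto nome atImInfty (𝓝 0) := by
  have := qParam_tendsto_atImInfty one_pos
  simpa only [qParam_one_eq_nome] using this

lemma tendsto_hauptmodul : Tendsto hauptmodul atImInfty (𝓝 0) := by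
  have h := tendsto_hauptmodul_div_nome.mul tendsto_nome
  rw [mul_zero] at h
  exact h.congr fun τ => div_mul_cancel₀ _ (nome_ne_zero τ)

lemma T_mem_Gamma0 (N : ℕ) : ModularGroup.T ∈ CongruenceSubgroup.Gamma0 N := by
  rw [CongruenceSubgroup.Gamma0_mem]; simp [ModularGroup.T]

/-- The Hauptmodul is a local coordinate `q ↦ W q` in the nome `q` at `i∞`. -/
lemma exists_hauptmodul_eq_nome :
    ∃ W : ℂ → ℂ, W 0 = 0 ∧ HasStrictDerivAt W 1 0 ∧ ∀ τ, hauptmodul τ = W (nome τ) := by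
  have hper : Function.Periodic (hauptmodul ∘ ofComplex) ((1 : ℝ) : ℂ) := by
    intro z
    by_cases hz : 0 < z.im
    · have hz' : 0 < (z + 1).im := by simpa
      simp only [Function.comp_apply]
      push_cast
      have : ofComplex (z + 1) = ModularGroup.T • ofComplex z := by
        ext
        rw [coe_T_smul, ofComplex_apply_of_im_pos hz, ofComplex_apply_of_im_pos hz']
      rw [this, hauptmodul_smul (T_mem_Gamma0 2)]
    · have hz' : ¬ 0 < (z + 1).im := by simpa using hz
      simp only [Function.comp_apply]
      push_cast
      rw [ofComplex_apply_of_im_nonpos (not_lt.1 hz), ofComplex_apply_of_im_nonpos (not_lt.1 hz')]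
  have han := analyticAt_cuspFunction_zero one_pos hper mdifferentiable_hauptmodul
    (tendsto_hauptmodul.isBigO_one ℝ)
  have hW (τ : ℍ) : hauptmodul τ = cuspFunction 1 hauptmodul (nome τ) := by
    rw [← qParam_one_eq_nome, eq_cuspFunction τ one_ne_zero hper]
  set W := cuspFunction 1 hauptmodul
  have h0 : W 0 = 0 := by
    refine tendsto_nhds_unique ?_ tendsto_hauptmodul
    exact (han.continuousAt.tendsto.comp tendsto_nome).congr fun τ => (hW τ).symm
  refine ⟨W, h0, ?_, hW⟩
  have hd := han.differentiableAt.hasDerivAt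
  -- The derivative is a limit of slopes, computed along `q = nome τ`, which tends to `0` through
  -- nonzero values.
  have h1 : deriv W 0 = 1 := by
    rw [hasDerivAt_iff_tendsto_slope] at hd
    have hn : Tendsto nome atImInfty (𝓝[≠] 0) :=
      tendsto_nhdsWithin_iff.2 ⟨tendsto_nome, .of_forall nome_ne_zero⟩
    refine tendsto_nhds_unique (hd.comp hn) (tendsto_hauptmodul_div_nome.congr fun τ => ?_)
    simp [slope, h0, hW τ, div_eq_inv_mul]
  rw [← h1]
  exact han.hasStrictDerivAt

/-! ### Openness and critical values of the Hauptmodul -/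

lemma analyticOnNhd_hauptmodul :
    AnalyticOnNhd ℂ (hauptmodul ∘ ofComplex) upperHalfPlaneSet :=
  (UpperHalfPlane.mdifferentiable_iff.1 mdifferentiable_hauptmodul).analyticOnNhd
    isOpen_upperHalfPlaneSet

lemma isPreconnected_upperHalfPlaneSet : IsPreconnected upperHalfPlaneSet :=
  (convex_halfSpace_im_gt 0).isPreconnected

lemma hauptmodul_not_const (c : ℂ) : ¬ ∀ τ, hauptmodul τ = c := by
  intro h
  have : Tendsto hauptmodul atImInfty (𝓝 c) := by
    rw [funext h]; exact tendsto_const_nhds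
  have hc := tendsto_nhds_unique this tendsto_hauptmodul
  exact hauptmodul_ne_zero UpperHalfPlane.I ((h _).trans hc)

lemma isOpenMap_hauptmodul : IsOpenMap hauptmodul := by
  refine IsOpenMap.of_nhds_le fun τ => ?_
  have hτ := analyticOnNhd_hauptmodul τ τ.im_pos
  have hmap : map (hauptmodul ∘ ofComplex) (𝓝 (τ : ℂ)) = map hauptmodul (𝓝 τ) := by
    rw [← isOpenEmbedding_coe.map_nhds_eq, Filter.map_map]
    congr 1; ext σ; simp
  rcases hτ.eventually_constant_or_nhds_le_map_nhds with h | h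
  · exfalso
    have := analyticOnNhd_hauptmodul.eqOn_of_preconnected_of_eventuallyEq
      (analyticOnNhd_const (v := hauptmodul τ)) isPreconnected_upperHalfPlaneSet τ.im_pos
      (by filter_upwards [h] with z hz; simpa using hz)
    refine hauptmodul_not_const (hauptmodul τ) fun σ => ?_
    simpa using this σ.im_pos
  · rw [hmap] at h
    simpa using h

/-- The critical values of the Hauptmodul. -/
def criticalValues : Set ℂ :=
  (hauptmodul ∘ ofComplex) '' {z | 0 < z.im ∧ deriv (hauptmodul ∘ ofComplex) z = 0}

/-- The derivative is not identically zero, so its zeros are isolated, and a discrete subset of the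
plane is countable. -/
lemma countable_criticalValues : criticalValues.Countable := by
  refine Set.Countable.image ?_ _
  have han := analyticOnNhd_hauptmodul.deriv
  refine IsLindelof.countable_of_isDiscrete
    (HereditarilyLindelofSpace.isLindelof _) ?_
  rcases han.eqOn_zero_or_eventually_ne_zero_of_preconnected isPreconnected_upperHalfPlaneSet
    with h | h
  · exfalso
    refine hauptmodul_not_const (hauptmodul (ofComplex Complex.I)) fun σ => ?_
    simpa using isOpen_upperHalfPlaneSet.is_const_of_deriv_eq_zero
      isPreconnected_upperHalfPlaneSet analyticOnNhd_hauptmodul.differentiableOn h σ.im_pos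
      UpperHalfPlane.I.im_pos
  · rw [isDiscrete_iff_nhdsNE]
    rintro z ⟨hz, -⟩
    rw [eventually_iff, mem_codiscreteWithin] at h
    have h' := h z hz
    rw [disjoint_principal_right] at h'
    rw [inf_principal_eq_bot]
    filter_upwards [h'] with w hw hw'
    exact hw ⟨hw'.1, by simpa using hw'.2⟩

lemma exists_local_inverse {τ : ℍ} (hτ : hauptmodul τ ∉ criticalValues) :
    ∃ d ≠ 0, HasStrictDerivAt (hauptmodul ∘ ofComplex) d τ := by
  have h := (analyticOnNhd_hauptmodul τ τ.im_pos).hasStrictDerivAt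
  refine ⟨_, fun h0 => hτ ?_, h⟩
  exact ⟨τ, ⟨τ.im_pos, h0⟩, by simp⟩

/-! ### Representatives modulo `Γ₀(2)` -/

instance : ContinuousConstSMul SL(2, ℤ) ℍ :=
  ⟨fun g => continuous_const_smul (Matrix.SpecialLinearGroup.mapGL ℝ g)⟩

instance : ContinuousConstSMul (CongruenceSubgroup.Gamma0 2) ℍ :=
  ⟨fun g => continuous_const_smul (g : SL(2, ℤ))⟩

lemma T_smul_im (τ : ℍ) : (ModularGroup.T • τ).im = τ.im := by
  rw [← coe_im, coe_T_smul]; simp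

/-- Up to `Γ₀(2)`, every point lies in a compact set or close to one of the two cusps. -/
lemma exists_compact_representatives (c : ℝ) : ∃ K : Set ℍ, IsCompact K ∧
    ∀ τ : ℍ, ∃ γ ∈ CongruenceSubgroup.Gamma0 2,
      γ • τ ∈ K ∨ c < (γ • τ).im ∨ c < (ModularGroup.S • γ • τ).im := by
  set K₀ := ModularGroup.truncatedFundamentalDomain c
  have hK₀ : IsCompact K₀ := ModularGroup.isCompact_truncatedFundamentalDomain c
  have hcont (g : SL(2, ℤ)) : Continuous fun τ : ℍ => g • τ := continuous_const_smul g
  refine ⟨K₀ ∪ (fun τ => ModularGroup.S • τ) '' K₀ ∪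
    (fun τ => (ModularGroup.S * ModularGroup.T) • τ) '' K₀,
    (hK₀.union (hK₀.image (hcont _))).union (hK₀.image (hcont _)), fun τ => ?_⟩
  obtain ⟨g, hg⟩ := ModularGroup.exists_smul_mem_fd τ
  have hz (h : (g • τ).im ≤ c) : g • τ ∈ K₀ := ⟨hg, h⟩
  -- `Γ₀(2)` has index 3: according to the first column of `g` modulo 2, one of `g`, `S g`, `S T g`
  -- lies in `Γ₀(2)`.
  by_cases hc : ((g 1 0 : ℤ) : ZMod 2) = 0
  · refine ⟨g, CongruenceSubgroup.Gamma0_mem.2 hc, ?_⟩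
    rcases le_or_gt (g • τ).im c with h | h
    · exact .inl (.inl (.inl (hz h)))
    · exact .inr (.inl h)
  by_cases ha : ((g 0 0 : ℤ) : ZMod 2) = 0
  · refine ⟨ModularGroup.S * g, CongruenceSubgroup.Gamma0_mem.2 ?_, ?_⟩
    · simpa [ModularGroup.coe_S, Matrix.mul_apply, Fin.sum_univ_two] using ha
    · rw [mul_smul]
      rcases le_or_gt (g • τ).im c with h | h
      · exact .inl (.inl (.inr ⟨_, hz h, rfl⟩))
      · rw [S_smul_S_smul]; exact .inr (.inr h)
  · refine ⟨ModularGroup.S * ModularGroup.T * g, CongruenceSubgroup.Gamma0_mem.2 ?_, ?_⟩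
    · have : ((g 0 0 : ℤ) : ZMod 2) + ((g 1 0 : ℤ) : ZMod 2) = 0 := by
        revert ha hc
        generalize ((g 0 0 : ℤ) : ZMod 2) = x
        generalize ((g 1 0 : ℤ) : ZMod 2) = y
        revert x y; decide
      simpa [ModularGroup.coe_S, ModularGroup.coe_T, Matrix.mul_apply, Fin.sum_univ_two] using this
    · rcases le_or_gt (g • τ).im c with h | h
      · exact .inl (.inr ⟨_, hz h, (mul_smul _ _ _).symm⟩)
      · rw [mul_smul, mul_smul, S_smul_S_smul, T_smul_im]; exact .inr (.inr h)

lemma exists_norm_hauptmodul_lt {r : ℝ} (hr : 0 < r) :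
    ∃ c : ℝ, ∀ τ : ℍ, c < τ.im → ‖hauptmodul τ‖ < r := by
  have h := tendsto_hauptmodul.eventually (Metric.ball_mem_nhds 0 hr)
  obtain ⟨c, hc⟩ := atImInfty_mem _ |>.1 h
  exact ⟨c, fun τ hτ => by simpa using hc τ hτ.le⟩

lemma exists_lt_norm_hauptmodul (R : ℝ) :
    ∃ c : ℝ, ∀ τ : ℍ, c < (ModularGroup.S • τ).im → R < ‖hauptmodul τ‖ := by
  obtain ⟨c, hc⟩ := exists_norm_hauptmodul_lt (r := (4096 * (|R| + 1))⁻¹) (by positivity)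
  -- The factor 2 compensates for `half` in the transformation under `S`.
  refine ⟨2 * c, fun τ hτ => ?_⟩
  have h := hc (half (ModularGroup.S • τ)) (by rw [half_im]; linarith)
  rw [← S_smul_S_smul τ, hauptmodul_S_smul, norm_inv, norm_mul]
  have h0 : 0 < ‖hauptmodul (half (ModularGroup.S • τ))‖ := norm_pos_iff.2 (hauptmodul_ne_zero _)
  have h1 := (lt_inv_comm₀ h0 (by positivity)).1 h
  rw [mul_inv, ← div_eq_inv_mul, lt_div_iff₀ (by simp)]
  refine lt_of_le_of_lt ?_ h1
  simp only [norm_ofNat]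
  nlinarith [le_abs_self R, abs_nonneg R]

/-- Properness modulo `Γ₀(2)`: small values occur near `∞` and large ones near `0`, so an annulus of
values excludes both horoballs. -/
lemma exists_compact_of_norm_hauptmodul {r : ℝ} (hr : 0 < r) (R : ℝ) :
    ∃ K : Set ℍ, IsCompact K ∧ ∀ τ : ℍ, r ≤ ‖hauptmodul τ‖ → ‖hauptmodul τ‖ ≤ R →
      ∃ γ ∈ CongruenceSubgroup.Gamma0 2, γ • τ ∈ K := by
  obtain ⟨c₁, h₁⟩ := exists_norm_hauptmodul_lt hr
  obtain ⟨c₂, h₂⟩ := exists_lt_norm_hauptmodul R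
  obtain ⟨K, hK, h⟩ := exists_compact_representatives (max c₁ c₂)
  refine ⟨K, hK, fun τ hτ hτ' => ?_⟩
  obtain ⟨γ, hγ, h | h | h⟩ := h τ
  · exact ⟨γ, hγ, h⟩
  · have := h₁ _ ((le_max_left _ _).trans_lt h)
    rw [hauptmodul_smul hγ] at this
    exact absurd this hτ.not_gt
  · have := h₂ _ ((le_max_right _ _).trans_lt h)
    rw [hauptmodul_smul hγ] at this
    exact absurd this hτ'.not_gt

/-! ### The Hauptmodul is a bijection from `ℍ / Γ₀(2)` to `ℂ ∖ {0}` -/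

lemma annulus_mem_nhds {w : ℂ} (hw : 0 < ‖w‖) :
    {z : ℂ | ‖w‖ / 2 < ‖z‖ ∧ ‖z‖ < 2 * ‖w‖} ∈ 𝓝 w :=
  ((continuous_norm.tendsto w).eventually (lt_mem_nhds (by linarith))).and
    ((continuous_norm.tendsto w).eventually (gt_mem_nhds (by linarith)))

/-- The range is open, and relatively closed in the connected set `ℂ ∖ {0}`: values near `v` are
already taken on one compact set, whose image is closed. -/
lemma exists_hauptmodul_eq {w : ℂ} (hw : w ≠ 0) : ∃ τ, hauptmodul τ = w := by
  have hpre : IsPreconnected ({0}ᶜ : Set ℂ) :=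
    (isConnected_compl_singleton_of_one_lt_rank (by simp) 0).isPreconnected
  have hsub := hpre.subset_of_closure_inter_subset isOpenMap_hauptmodul.isOpen_range
    ⟨hauptmodul UpperHalfPlane.I, hauptmodul_ne_zero _, ⟨_, rfl⟩⟩ ?_
  · exact hsub hw
  rintro v ⟨hv, hv0⟩
  have hv0' : 0 < ‖v‖ := norm_pos_iff.2 hv0
  obtain ⟨K, hK, h⟩ := exists_compact_of_norm_hauptmodul (half_pos hv0') (2 * ‖v‖)
  have hcl : IsClosed (hauptmodul '' K) := (hK.image continuous_hauptmodul).isClosed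
  suffices v ∈ hauptmodul '' K from Set.image_subset_range _ _ this
  rw [← hcl.closure_eq, mem_closure_iff_nhds]
  intro U hU
  have hN := annulus_mem_nhds hv0'
  obtain ⟨_, ⟨hzU, hz1, hz2⟩, τ, rfl⟩ := mem_closure_iff_nhds.1 hv _ (inter_mem hU hN)
  obtain ⟨γ, hγ, hγK⟩ := h τ hz1.le hz2.le
  exact ⟨_, hzU, γ • τ, hγK, hauptmodul_smul hγ τ⟩

/-- The open modular curve. -/
abbrev OpenCurve : Type := MulAction.orbitRel.Quotient (CongruenceSubgroup.Gamma0 2) ℍ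

/-- The class of a point of `ℍ` in the open modular curve. -/
def orbit (τ : ℍ) : OpenCurve := Quotient.mk _ τ

lemma orbit_eq_iff {σ τ : ℍ} :
    orbit σ = orbit τ ↔ ∃ γ ∈ CongruenceSubgroup.Gamma0 2, γ • τ = σ := by
  rw [orbit, orbit, Quotient.eq, MulAction.orbitRel_apply, MulAction.mem_orbit_iff]
  exact ⟨fun ⟨γ, h⟩ => ⟨γ, γ.2, h⟩, fun ⟨γ, hγ, h⟩ => ⟨⟨γ, hγ⟩, h⟩⟩

instance : ProperlyDiscontinuousSMul (CongruenceSubgroup.Gamma0 2) ℍ := by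
  rw [Subgroup.properlyDiscontinuousSMul_iff]
  intro K L hK hL
  have h := (Subgroup.properlyDiscontinuousSMul_iff (Γ := GL (Fin 2) ℝ) (α := ℍ) 𝒮ℒ).1
    inferInstance hK hL
  refine Set.Finite.of_finite_image (f := Matrix.SpecialLinearGroup.mapGL ℝ) (h.subset ?_)
    (Matrix.SpecialLinearGroup.mapGL_injective.injOn)
  rintro _ ⟨γ, ⟨-, hγ⟩, rfl⟩
  exact ⟨⟨γ, rfl⟩, hγ⟩

instance : T2Space OpenCurve :=
  t2Space_of_properlyDiscontinuousSMul_of_t2Space (Γ := CongruenceSubgroup.Gamma0 2) (T := ℍ)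

lemma exists_injOn_of_hasStrictDerivAt {f : ℂ → ℂ} {d a : ℂ} (h : HasStrictDerivAt f d a)
    (hd : d ≠ 0) : ∃ U ∈ 𝓝 a, Set.InjOn f U := by
  have h' := h.hasStrictFDerivAt_equiv hd
  exact ⟨_, (h'.toOpenPartialHomeomorph f).open_source.mem_nhds
    h'.mem_toOpenPartialHomeomorph_source, (h'.toOpenPartialHomeomorph f).injOn⟩

lemma orbit_eq_of_nome_eq {σ τ : ℍ} (h : nome σ = nome τ) : orbit σ = orbit τ := by
  obtain ⟨n, hn⟩ := Complex.exp_eq_exp_iff_exists_int.1 h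
  refine orbit_eq_iff.2 ⟨ModularGroup.T ^ n, zpow_mem (T_mem_Gamma0 2) n, ?_⟩
  rw [modular_T_zpow_smul]
  ext
  have hpi : (2 * π * Complex.I : ℂ) ≠ 0 := two_pi_I_ne_zero
  apply mul_left_cancel₀ hpi
  rw [hn, coe_vadd]
  push_cast; ring

/-- A small value forces a representative near `∞`, since `|w|` is bounded below on the compact part
and exceeds 1 near the cusp `0`. There `w` is an injective function of `q`, and `q` determines `τ`
up to powers of `T`. -/
lemma exists_orbit_eq_of_norm_lt : ∃ r > 0, ∀ σ τ : ℍ, hauptmodul σ = hauptmodul τ →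
    ‖hauptmodul τ‖ < r → orbit σ = orbit τ := by
  obtain ⟨W, -, hW, hW'⟩ := exists_hauptmodul_eq_nome
  obtain ⟨U, hU, hinj⟩ := exists_injOn_of_hasStrictDerivAt hW one_ne_zero
  obtain ⟨c₁, hc₁⟩ := atImInfty_mem _ |>.1 (tendsto_nome.eventually hU)
  obtain ⟨c₂, hc₂⟩ := exists_lt_norm_hauptmodul 1
  obtain ⟨K, hK, h⟩ := exists_compact_representatives (max c₁ c₂)
  have hpos : ∃ r > 0, ∀ τ ∈ K, r ≤ ‖hauptmodul τ‖ := by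
    rcases K.eq_empty_or_nonempty with rfl | hne
    · exact ⟨1, one_pos, by simp⟩
    · obtain ⟨τ₀, -, hmin⟩ := hK.exists_isMinOn hne continuous_hauptmodul.norm.continuousOn
      exact ⟨_, norm_pos_iff.2 (hauptmodul_ne_zero τ₀), fun τ hτ => hmin hτ⟩
  obtain ⟨r, hr, hrK⟩ := hpos
  have key (τ : ℍ) (hτ : ‖hauptmodul τ‖ < min r 1) :
      ∃ τ' : ℍ, orbit τ = orbit τ' ∧ hauptmodul τ' = hauptmodul τ ∧ nome τ' ∈ U := by
    obtain ⟨γ, hγ, h⟩ := h τ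
    have hinv := hauptmodul_smul hγ τ
    refine ⟨γ • τ, (orbit_eq_iff.2 ⟨γ, hγ, rfl⟩).symm, hinv, ?_⟩
    rw [← hinv] at hτ
    rcases h with h | h | h
    · exact absurd (hτ.trans_le (min_le_left _ _)) (hrK _ h).not_gt
    · exact hc₁ _ ((le_max_left _ _).trans h.le)
    · exact absurd (hτ.trans_le (min_le_right _ _))
        (hc₂ _ ((le_max_right _ _).trans_lt h)).not_gt
  refine ⟨min r 1, lt_min hr one_pos, fun σ τ hστ hτ => ?_⟩
  obtain ⟨τ', h1, h2, h3⟩ := key τ hτ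
  obtain ⟨σ', h4, h5, h6⟩ := key σ (hστ ▸ hτ)
  rw [h1, h4]
  refine orbit_eq_of_nome_eq (hinj h6 h3 ?_)
  rw [← hW', ← hW', h5, h2, hστ]

lemma isOpenMap_hauptmodul_preimage {U : Set OpenCurve} (hU : IsOpen U) :
    IsOpen (hauptmodul '' (orbit ⁻¹' U)) :=
  isOpenMap_hauptmodul _ (hU.preimage continuous_quotient_mk')

/-- The values which the Hauptmodul takes at inequivalent points. -/
def multipleValues : Set ℂ :=
  {w | ∃ σ τ : ℍ, orbit σ ≠ orbit τ ∧ hauptmodul σ = w ∧ hauptmodul τ = w}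

/-- Two distinct orbits have disjoint neighbourhoods, and the open map sends both onto
neighbourhoods of the common value. -/
lemma isOpen_multipleValues : IsOpen multipleValues := by
  rw [isOpen_iff_mem_nhds]
  rintro w ⟨σ, τ, hne, hσ, hτ⟩
  obtain ⟨U, V, hU, hV, hσU, hτV, hUV⟩ := t2_separation hne
  have h1 := (isOpenMap_hauptmodul_preimage hU).mem_nhds ⟨σ, hσU, hσ⟩
  have h2 := (isOpenMap_hauptmodul_preimage hV).mem_nhds ⟨τ, hτV, hτ⟩
  filter_upwards [h1, h2]
  rintro v ⟨σ', hσ', rfl⟩ ⟨τ', hτ', h⟩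
  refine ⟨σ', τ', fun he => ?_, rfl, h⟩
  exact Set.disjoint_left.1 hUV hσ' (he ▸ hτ')

lemma exists_injOn_hauptmodul {τ : ℍ} (hτ : hauptmodul τ ∉ criticalValues) :
    ∃ U ∈ 𝓝 τ, Set.InjOn hauptmodul U := by
  obtain ⟨d, hd, h⟩ := exists_local_inverse hτ
  obtain ⟨U, hU, hinj⟩ := exists_injOn_of_hasStrictDerivAt h hd
  refine ⟨UpperHalfPlane.coe ⁻¹' U, continuous_coe.continuousAt hU, fun a ha b hb hab => ?_⟩
  exact UpperHalfPlane.ext (hinj ha hb (by simpa using hab))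

/-- Choose pairs of inequivalent points in a compact set, with values converging to `w`. A
subsequence of pairs converges, and its two limits both have value `w`. -/
lemma closure_multipleValues_inter_subset :
    closure multipleValues ∩ (insert 0 criticalValues)ᶜ ⊆ multipleValues := by
  rintro w ⟨hw, hw'⟩
  rw [Set.mem_compl_iff, Set.mem_insert_iff, not_or] at hw'
  have hw0 : 0 < ‖w‖ := norm_pos_iff.2 hw'.1
  obtain ⟨K, hK, h⟩ := exists_compact_of_norm_hauptmodul (half_pos hw0) (2 * ‖w‖)
  have hN := annulus_mem_nhds hw0
  obtain ⟨u, hu, hlim⟩ := mem_closure_iff_seq_limit.1 hw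
  obtain ⟨N, hN⟩ := eventually_atTop.1 (hlim.eventually hN)
  have hex (n : ℕ) : ∃ p : ℍ × ℍ, p ∈ K ×ˢ K ∧ orbit p.1 ≠ orbit p.2 ∧
      hauptmodul p.1 = u (n + N) ∧ hauptmodul p.2 = u (n + N) := by
    obtain ⟨σ, τ, hne, hσ, hτ⟩ := hu (n + N)
    obtain ⟨h1, h2⟩ := hN (n + N) (Nat.le_add_left _ _)
    obtain ⟨γ, hγ, hγK⟩ := h σ (hσ ▸ h1.le) (hσ ▸ h2.le)
    obtain ⟨δ, hδ, hδK⟩ := h τ (hτ ▸ h1.le) (hτ ▸ h2.le)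
    refine ⟨(γ • σ, δ • τ), ⟨hγK, hδK⟩, ?_, ?_, ?_⟩
    · rwa [orbit_eq_iff.2 ⟨γ, hγ, rfl⟩, orbit_eq_iff.2 ⟨δ, hδ, rfl⟩]
    · rw [hauptmodul_smul hγ, hσ]
    · rw [hauptmodul_smul hδ, hτ]
  choose p hpK hpne hp1 hp2 using hex
  obtain ⟨⟨a, b⟩, -, φ, hφ, hconv⟩ := (hK.prod hK).tendsto_subseq hpK
  have ha : Tendsto (fun n => (p (φ n)).1) atTop (𝓝 a) := (continuous_fst.tendsto _).comp hconv
  have hb : Tendsto (fun n => (p (φ n)).2) atTop (𝓝 b) := (continuous_snd.tendsto _).comp hconv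
  have hlim' : Tendsto (fun n => u (φ n + N)) atTop (𝓝 w) :=
    hlim.comp ((tendsto_add_atTop_nat N).comp hφ.tendsto_atTop)
  have hta : hauptmodul a = w := tendsto_nhds_unique
    ((continuous_hauptmodul.tendsto a).comp ha) (hlim'.congr fun n => (hp1 _).symm)
  have htb : hauptmodul b = w := tendsto_nhds_unique
    ((continuous_hauptmodul.tendsto b).comp hb) (hlim'.congr fun n => (hp2 _).symm)
  refine ⟨a, b, fun hab => ?_, hta, htb⟩
  -- If the limits were equivalent, moving the second sequence by `γ` would make both converge to
  -- the same noncritical point, against local injectivity there.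
  obtain ⟨γ, hγ, rfl⟩ := orbit_eq_iff.1 hab
  obtain ⟨U, hU, hinj⟩ := exists_injOn_hauptmodul (τ := γ • b) (hta ▸ hw'.2)
  have hb' : Tendsto (fun n => γ • (p (φ n)).2) atTop (𝓝 (γ • b)) :=
    ((continuous_const_smul γ).tendsto b).comp hb
  obtain ⟨n, hn1, hn2⟩ := ((ha.eventually hU).and (hb'.eventually hU)).exists
  refine hpne (φ n) (orbit_eq_iff.2 ⟨γ, hγ, (hinj hn1 hn2 ?_).symm⟩)
  rw [hauptmodul_smul hγ, hp1, hp2]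

lemma multipleValues_eq_empty : multipleValues = ∅ := by
  have hcount : (insert 0 criticalValues).Countable := countable_criticalValues.insert 0
  have hpre : IsPreconnected (insert 0 criticalValues)ᶜ :=
    (hcount.isConnected_compl_of_one_lt_rank (by simp)).isPreconnected
  have hdense : Dense (insert 0 criticalValues)ᶜ := hcount.dense_compl ℝ
  by_contra hne
  have hsub := hpre.subset_of_closure_inter_subset isOpen_multipleValues
    (by
      rw [Set.inter_comm]
      exact hdense.inter_open_nonempty _ isOpen_multipleValues (Set.nonempty_iff_ne_empty.2 hne))
    closure_multipleValues_inter_subset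
  obtain ⟨r, hr, h⟩ := exists_orbit_eq_of_norm_lt
  obtain ⟨w, hw, hw'⟩ := hdense.inter_open_nonempty _ Metric.isOpen_ball
    (Metric.nonempty_ball.2 hr : (Metric.ball (0 : ℂ) r).Nonempty)
  obtain ⟨σ, τ, hστ, rfl, hτ⟩ := hsub hw'
  exact hστ (h σ τ hτ.symm (by rw [hτ]; simpa using hw))

lemma orbit_eq_of_hauptmodul_eq {σ τ : ℍ} (h : hauptmodul σ = hauptmodul τ) :
    orbit σ = orbit τ := by
  by_contra hne
  have : hauptmodul τ ∈ multipleValues := ⟨σ, τ, hne, h, rfl⟩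
  rw [multipleValues_eq_empty] at this
  exact this

/-! ### Weighted projective lines -/

namespace WProj

lemma mk_eq_iff {a b : ℕ} {v w : ℂ × ℂ} {hv : v ≠ 0} {hw : w ≠ 0} :
    mk a b v hv = mk a b w hw ↔ ∃ l : ℂˣ, w = ((l : ℂ) ^ a * v.1, (l : ℂ) ^ b * v.2) :=
  Quotient.eq

lemma mk_eq_of {a b : ℕ} {v w : ℂ × ℂ} {hv : v ≠ 0} {hw : w ≠ 0} {l : ℂ} (hl : l ≠ 0)
    (h1 : w.1 = l ^ a * v.1) (h2 : w.2 = l ^ b * v.2) : mk a b v hv = mk a b w hw :=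
  mk_eq_iff.2 ⟨Units.mk0 l hl, Prod.ext h1 h2⟩

lemma exists_mk {a b : ℕ} (p : WProj a b) : ∃ v hv, p = mk a b v hv := by
  induction p using Quotient.inductionOn with
  | h v => exact ⟨v.1, v.2, rfl⟩

lemma continuous_mk (a b : ℕ) : Continuous fun v : {v : ℂ × ℂ // v ≠ 0} => mk a b v.1 v.2 :=
  continuous_quotient_mk'

lemma isOpen_preimage_mk {a b : ℕ} {U : Set (WProj a b)} (hU : IsOpen U) :
    IsOpen {v | ∃ hv : v ≠ 0, mk a b v hv ∈ U} := by
  have h := (isOpen_compl_singleton (x := (0 : ℂ × ℂ))).isOpenMap_subtype_val _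
    (hU.preimage (continuous_mk a b))
  convert h using 1
  ext v
  exact ⟨fun ⟨hv, h⟩ => ⟨⟨v, hv⟩, h, rfl⟩, fun ⟨⟨v, hv⟩, h, e⟩ => e ▸ ⟨hv, h⟩⟩

lemma tendsto_mk {ι : Type*} {l : Filter ι} {a b : ℕ} {v : ι → ℂ × ℂ} (hv : ∀ i, v i ≠ 0)
    {w : ℂ × ℂ} (hw : w ≠ 0) (h : Tendsto v l (𝓝 w)) :
    Tendsto (fun i => mk a b (v i) (hv i)) l (𝓝 (mk a b w hw)) :=
  ((continuous_mk a b).tendsto ⟨w, hw⟩).comp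
    (tendsto_subtype_rng.2 h : Tendsto (fun i => (⟨v i, hv i⟩ : {v : ℂ × ℂ // v ≠ 0})) l _)

/-- `ℙ(1, 2)` is the projective line with coordinates `[x² : y]`. -/
lemma mk_one_two_eq_iff {v w : ℂ × ℂ} {hv : v ≠ 0} {hw : w ≠ 0} :
    mk 1 2 v hv = mk 1 2 w hw ↔ v.1 ^ 2 * w.2 = w.1 ^ 2 * v.2 := by
  constructor
  · intro h
    obtain ⟨l, rfl⟩ := mk_eq_iff.1 h
    ring
  · intro h
    by_cases hv2 : v.2 = 0
    · have hv1 : v.1 ≠ 0 := fun h1 => hv (Prod.ext h1 hv2)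
      have hw2 : w.2 = 0 := by simpa [hv2, hv1] using h
      have hw1 : w.1 ≠ 0 := fun h1 => hw (Prod.ext h1 hw2)
      exact mk_eq_of (div_ne_zero hw1 hv1) (by field_simp) (by rw [hv2, hw2, mul_zero])
    · have hw2 : w.2 ≠ 0 := fun h2 => hw (Prod.ext (by simpa [h2, hv2] using h) h2)
      obtain ⟨l, hl⟩ := IsAlgClosed.exists_pow_nat_eq (w.2 / v.2) two_pos
      have hl0 : l ≠ 0 := by
        rintro rfl
        rw [zero_pow two_ne_zero] at hl
        exact div_ne_zero hw2 hv2 hl.symm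
      have h2 : w.2 = l ^ 2 * v.2 := by rw [hl, div_mul_cancel₀ _ hv2]
      have h1 : w.1 ^ 2 = (l * v.1) ^ 2 := by
        apply mul_right_cancel₀ hv2
        rw [← h, h2]; ring
      rcases sq_eq_sq_iff_eq_or_eq_neg.1 h1 with h1 | h1
      · exact mk_eq_of hl0 (by rw [h1, pow_one]) h2
      · exact mk_eq_of (neg_ne_zero.2 hl0) (by rw [h1]; ring) (by rw [h2]; ring)

/-- Because `λ = -1` identifies `(x, y)` with `(-x, y)`, the sign of the first coordinate may be
chosen nearest the limit. The chosen `s` satisfies `|s - w|² ≤ |s - w||s + w| = |s² - w²|`. -/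
lemma tendsto_mk_one_two {ι : Type*} {l : Filter ι} {v : ι → ℂ × ℂ} (hv : ∀ i, v i ≠ 0)
    {w : ℂ × ℂ} (hw : w ≠ 0) (h1 : Tendsto (fun i => (v i).1 ^ 2) l (𝓝 (w.1 ^ 2)))
    (h2 : Tendsto (fun i => (v i).2) l (𝓝 w.2)) :
    Tendsto (fun i => mk 1 2 (v i) (hv i)) l (𝓝 (mk 1 2 w hw)) := by
  classical
  set s : ι → ℂ := fun i =>
    if ‖(v i).1 - w.1‖ ≤ ‖(v i).1 + w.1‖ then (v i).1 else -(v i).1 with hs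
  have hsq (i : ι) : s i ^ 2 = (v i).1 ^ 2 := by
    simp only [hs]; split_ifs <;> ring
  have hne (i : ι) : (s i, (v i).2) ≠ (0 : ℂ × ℂ) := by
    intro h
    have h1 : s i = 0 := congrArg Prod.fst h
    have := hsq i
    rw [h1, zero_pow two_ne_zero, eq_comm, sq_eq_zero_iff] at this
    have h2 : (v i).2 = 0 := congrArg Prod.snd h
    exact hv i (Prod.ext this h2)
  have heq (i : ι) : mk 1 2 (s i, (v i).2) (hne i) = mk 1 2 (v i) (hv i) :=
    mk_one_two_eq_iff.2 (by simp only [hsq])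
  simp only [← heq]
  suffices hlim : Tendsto s l (𝓝 w.1) from tendsto_mk hne hw (hlim.prodMk_nhds h2)
  have hle (i : ι) : ‖s i - w.1‖ ^ 2 ≤ ‖(v i).1 ^ 2 - w.1 ^ 2‖ := by
    rw [sq_sub_sq, norm_mul, sq]
    simp only [hs]
    split_ifs with h
    · exact mul_le_mul_of_nonneg_right h (norm_nonneg _)
    · rw [← norm_neg, neg_sub, sub_neg_eq_add, add_comm w.1]
      exact mul_le_mul_of_nonneg_left (not_le.1 h).le (norm_nonneg _)
  have h0 : Tendsto (fun i => ‖(v i).1 ^ 2 - w.1 ^ 2‖) l (𝓝 0) := by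
    simpa using (tendsto_iff_norm_sub_tendsto_zero.1 h1)
  have h3 : Tendsto (fun i => ‖s i - w.1‖ ^ 2) l (𝓝 0) :=
    squeeze_zero (fun i => by positivity) hle h0
  rw [tendsto_iff_norm_sub_tendsto_zero]
  have := (Real.continuous_sqrt.tendsto 0).comp h3
  simpa [Function.comp_def, Real.sqrt_sq] using this

/-- The denominator of `stereo`. -/
def stereoDenom (v : ℂ × ℂ) : ℂ := v.1 ^ 2 * conj (v.1 ^ 2) + v.2 * conj v.2

/-- The stereographic embedding of `ℙ(1, 2)` into `ℂ²`, on homogeneous coordinates. -/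
def stereo (v : ℂ × ℂ) : ℂ × ℂ :=
  (v.1 ^ 2 * conj v.2 / stereoDenom v, v.2 * conj v.2 / stereoDenom v)

lemma stereoDenom_ne_zero {v : ℂ × ℂ} (hv : v ≠ 0) : stereoDenom v ≠ 0 := by
  rw [stereoDenom, Complex.mul_conj, Complex.mul_conj, ← Complex.ofReal_add]
  intro h
  rw [Complex.ofReal_eq_zero, add_eq_zero_iff_of_nonneg (normSq_nonneg _) (normSq_nonneg _),
    normSq_eq_zero, normSq_eq_zero] at h
  exact hv (Prod.ext (by simpa using h.1) h.2)

/-- The pair `stereo` consists of two entries of the orthogonal projection onto the line spanned by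
`(x², y)`. It is invariant under the action and determines `[x² : y]`, so it injects the quotient
continuously into `ℂ²`. -/
instance : T2Space (WProj 1 2) := by
  let F : WProj 1 2 → ℂ × ℂ := Quotient.lift (fun v : {v : ℂ × ℂ // v ≠ 0} => stereo v.1) (by
    rintro ⟨v, hv⟩ ⟨w, hw⟩ ⟨l, rfl⟩
    have h1 := stereoDenom_ne_zero hv
    have h2 := stereoDenom_ne_zero hw
    have hd : stereoDenom ((l : ℂ) ^ 1 * v.1, (l : ℂ) ^ 2 * v.2)
        = (l : ℂ) ^ 2 * conj ((l : ℂ) ^ 2) * stereoDenom v := by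
      simp only [stereoDenom, map_mul, map_pow]; ring
    rw [hd] at h2
    simp only [stereo, hd, map_mul]
    ext
    · simp only
      rw [div_eq_div_iff h1 h2]; ring
    · simp only
      rw [div_eq_div_iff h1 h2]; ring)
  have hF : Continuous F := by
    refine Continuous.quotient_lift ?_ _
    have hc : Continuous fun v : {v : ℂ × ℂ // v ≠ 0} => stereoDenom v.1 := by
      unfold stereoDenom; fun_prop
    unfold stereo
    exact (Continuous.div (by fun_prop) hc fun v => stereoDenom_ne_zero v.2).prodMk
      (Continuous.div (by fun_prop) hc fun v => stereoDenom_ne_zero v.2)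
  refine T2Space.of_injective_continuous (f := F) ?_ hF
  intro p q h
  obtain ⟨v, hv, rfl⟩ := exists_mk p
  obtain ⟨w, hw, rfl⟩ := exists_mk q
  have h' : stereo v = stereo w := h
  have hN := stereoDenom_ne_zero hv
  have hM := stereoDenom_ne_zero hw
  have h1 := congrArg Prod.fst h'
  have h2 := congrArg Prod.snd h'
  simp only [stereo] at h1 h2
  rw [div_eq_div_iff hN hM] at h1 h2
  rw [mk_one_two_eq_iff]
  by_cases hv2 : v.2 = 0
  · have hw2 : w.2 = 0 := by
      rw [hv2] at h2
      simpa [hN] using h2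
    rw [hv2, hw2, mul_zero, mul_zero]
  · have hw2 : w.2 ≠ 0 := by
      intro h0
      rw [h0] at h2
      simp [hM, hv2] at h2
    have hc1 : conj v.2 ≠ 0 := by simpa using hv2
    have hc2 : conj w.2 ≠ 0 := by simpa using hw2
    apply mul_right_cancel₀ (mul_ne_zero (mul_ne_zero hc1 hc2) (mul_ne_zero hN hM))
    linear_combination (w.2 * conj w.2 * stereoDenom v) * h1
      - (w.1 ^ 2 * conj w.2 * stereoDenom v) * h2

end WProj

open WProj

/-- The affine line `y / (x² - 64 y) = w` in `ℙ(1, 2)`, which omits the point `[8 : 1]`. -/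
def lineInfty (w : ℂ) : WProj 1 2 :=
  mk 1 2 ((1 + 64 * w) ^ (1 / 2 : ℂ), w) fun h => by
    have h2 : w = 0 := congrArg Prod.snd h
    have h1 : (1 + 64 * w) ^ (1 / 2 : ℂ) = 0 := congrArg Prod.fst h
    simp [h2] at h1

/-- The affine line `(x² - 64 y) / y = w` in `ℙ(1, 2)`, which omits the point `[1 : 0]`. -/
def lineZero (w : ℂ) : WProj 1 2 :=
  mk 1 2 ((64 + w) ^ (1 / 2 : ℂ), 1) fun h => one_ne_zero (congrArg Prod.snd h)

/-- The principal square root jumps across its cut, but only its square affects convergence in `ℙ(1,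
2)`. -/
lemma continuous_lineInfty : Continuous lineInfty := by
  refine continuous_iff_continuousAt.2 fun w => tendsto_mk_one_two _ _ ?_ tendsto_id
  simp only [cpow_half_sq]
  exact Continuous.tendsto (by fun_prop) w

lemma continuous_lineZero : Continuous lineZero := by
  refine continuous_iff_continuousAt.2 fun w => tendsto_mk_one_two _ _ ?_ tendsto_const_nhds
  simp only [cpow_half_sq]
  exact Continuous.tendsto (by fun_prop) w

lemma mk_eq_lineInfty {v : ℂ × ℂ} {hv : v ≠ 0} (h : v.1 ^ 2 - 64 * v.2 ≠ 0) :
    mk 1 2 v hv = lineInfty (v.2 / (v.1 ^ 2 - 64 * v.2)) := by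
  rw [lineInfty, mk_one_two_eq_iff]
  simp only [cpow_half_sq]
  rw [mul_div_assoc', div_eq_iff h, add_mul, add_mul, one_mul, mul_assoc, mul_assoc]
  have e := div_mul_cancel₀ v.2 h
  linear_combination (-64 * v.2) * e

lemma mk_eq_lineZero {v : ℂ × ℂ} {hv : v ≠ 0} (h : v.2 ≠ 0) :
    mk 1 2 v hv = lineZero ((v.1 ^ 2 - 64 * v.2) / v.2) := by
  rw [lineZero, mk_one_two_eq_iff]
  simp only [cpow_half_sq]
  field_simp
  ring

lemma lineInfty_zero : lineInfty 0 = mk 1 2 (1, 0) (by simp) := by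
  rw [lineInfty, mk_one_two_eq_iff]; simp

lemma lineZero_zero : lineZero 0 = mk 1 2 (8, 1) (by simp) := by
  rw [lineZero, mk_one_two_eq_iff]; simp only [cpow_half_sq]; norm_num

lemma lineZero_inv {w : ℂ} (hw : w ≠ 0) : lineZero w⁻¹ = lineInfty w := by
  rw [lineZero, lineInfty, mk_one_two_eq_iff]; simp only [cpow_half_sq]; field_simp; ring

lemma lineInfty_injective : Function.Injective lineInfty := by
  intro v w h
  rw [lineInfty, lineInfty, mk_one_two_eq_iff] at h
  simp only [cpow_half_sq] at h
  linear_combination -h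

lemma lineInfty_ne (w : ℂ) : lineInfty w ≠ mk 1 2 (8, 1) (by simp) := by
  intro h
  rw [lineInfty, mk_one_two_eq_iff] at h
  simp only [cpow_half_sq] at h
  have : (1 : ℂ) = 0 := by linear_combination h
  exact one_ne_zero this

lemma mk_h_eq_lineInfty (τ : ℍ) :
    mk 1 2 (h₁ τ, h₂ τ) (h_ne_zero τ) = lineInfty (hauptmodul τ) :=
  mk_eq_lineInfty (h₁_sq_sub_ne_zero τ)

/-! ### The limits at the cusps -/

lemma tendsto_h_atImInfty : Tendsto (fun τ => (h₁ τ, h₂ τ)) atImInfty (𝓝 (8, 0)) := by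
  have h1 := ((tendsto_theta_zero_zero.pow 4).add (tendsto_theta_zero_one.pow 4)).const_mul 4
  have h2 := (((tendsto_theta_zero_zero.pow 4).sub
    (tendsto_theta_zero_one.pow 4)).pow 2).div_const 4
  norm_num at h1 h2
  exact h1.prodMk_nhds h2

lemma tendsto_mk_h_atImInfty : Tendsto (fun τ => mk 2 4 (h₁ τ, h₂ τ) (h_ne_zero τ)) atImInfty
    (𝓝 (mk 2 4 (1, 0) (by simp))) := by
  obtain ⟨l, hl⟩ := IsAlgClosed.exists_pow_nat_eq (8 : ℂ) two_pos
  have hl0 : l ≠ 0 := by rintro rfl; norm_num at hl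
  have : mk 2 4 ((1, 0) : ℂ × ℂ) (by simp) = mk 2 4 (8, 0) (by simp) :=
    mk_eq_of hl0 (by simp [hl]) (by simp)
  rw [this]
  exact tendsto_mk h_ne_zero _ tendsto_h_atImInfty

lemma h_S_smul (τ : ℍ) :
    h₁ (ModularGroup.S • τ) = (τ : ℂ) ^ 2 * (-4 * (theta 0 0 τ ^ 4 + theta 1 0 τ ^ 4)) ∧
    h₂ (ModularGroup.S • τ) = (τ : ℂ) ^ 4 * ((theta 0 1 τ ^ 4) ^ 2 / 4) := by
  rw [h₁, h₂_eq, theta_zero_zero_S_pow_four, theta_zero_one_S_pow_four,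
    show ∀ z : ℂ, z ^ 8 = (z ^ 4) ^ 2 from fun z => by ring, theta_one_zero_S_pow_four]
  constructor <;> ring

lemma tendsto_mk_h_S_smul : Tendsto
    (fun τ => mk 2 4 (h₁ (ModularGroup.S • τ), h₂ (ModularGroup.S • τ)) (h_ne_zero _)) atImInfty
    (𝓝 (mk 2 4 (8, 1) (by simp))) := by
  -- After the automorphy factor is removed, the limit is `(-4, 1/4)`; scaling with `λ² = -2`
  -- carries it to `(8, 1)`.
  obtain ⟨l, hl⟩ := IsAlgClosed.exists_pow_nat_eq (-2 : ℂ) two_pos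
  have hl0 : l ≠ 0 := by rintro rfl; norm_num at hl
  have h81 : mk 2 4 ((-4, 1 / 4) : ℂ × ℂ) (by simp) = mk 2 4 (8, 1) (by simp) :=
    mk_eq_of hl0 (by simp only [hl]; norm_num)
      (by rw [show l ^ 4 = (l ^ 2) ^ 2 by ring, hl]; norm_num)
  set v : ℍ → ℂ × ℂ := fun τ =>
    (-4 * (theta 0 0 τ ^ 4 + theta 1 0 τ ^ 4), (theta 0 1 τ ^ 4) ^ 2 / 4)
  have hv (τ : ℍ) : v τ ≠ 0 := by
    intro h
    apply h_ne_zero (ModularGroup.S • τ)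
    have h1 : -4 * (theta 0 0 τ ^ 4 + theta 1 0 τ ^ 4) = 0 := congrArg Prod.fst h
    have h2 : (theta 0 1 τ ^ 4) ^ 2 / 4 = 0 := congrArg Prod.snd h
    rw [(h_S_smul τ).1, (h_S_smul τ).2, h1, h2, mul_zero, mul_zero]; rfl
  have heq (τ : ℍ) : mk 2 4 (v τ) (hv τ)
      = mk 2 4 (h₁ (ModularGroup.S • τ), h₂ (ModularGroup.S • τ)) (h_ne_zero _) :=
    mk_eq_of τ.ne_zero (h_S_smul τ).1 (h_S_smul τ).2
  simp only [← heq]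
  rw [← h81]
  refine tendsto_mk hv _ ?_
  have h1 := ((tendsto_theta_zero_zero.pow 4).add (tendsto_theta_one_zero.pow 4)).const_mul (-4)
  have h2 := ((tendsto_theta_zero_one.pow 4).pow 2).div_const 4
  refine Tendsto.prodMk_nhds ?_ ?_
  · convert h1 using 2; norm_num
  · convert h2 using 2; norm_num

lemma tendsto_ofComplex_I_mul {a : ℝ} (ha : 0 < a) :
    Tendsto (fun t : ℝ => ofComplex (a * (Complex.I * t))) atTop atImInfty := by
  rw [atImInfty, tendsto_comap_iff]
  refine ((tendsto_const_mul_atTop_of_pos ha).2 tendsto_id).congr' ?_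
  filter_upwards [eventually_gt_atTop 0] with t ht
  have : 0 < (a * (Complex.I * t) : ℂ).im := by simpa using mul_pos ha ht
  rw [Function.comp_apply, ofComplex_apply_of_im_pos this, ← coe_im, coe_mk]
  simp

lemma tendsto_mk_h_cusp_infty : Tendsto
    (fun t : ℝ => mk 2 4 (h₁ (ofComplex (Complex.I * t)), h₂ (ofComplex (Complex.I * t)))
      (h_ne_zero _)) atTop (𝓝 (mk 2 4 (1, 0) (by simp))) := by
  have h := tendsto_mk_h_atImInfty.comp (tendsto_ofComplex_I_mul one_pos)
  simpa only [ofReal_one, one_mul, Function.comp_def] using h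

lemma tendsto_mk_h_cusp_zero : Tendsto
    (fun t : ℝ => mk 2 4 (h₁ (ofComplex (-1 / (2 * (Complex.I * t)))),
      h₂ (ofComplex (-1 / (2 * (Complex.I * t))))) (h_ne_zero _)) atTop
    (𝓝 (mk 2 4 (8, 1) (by simp))) := by
  have h := tendsto_mk_h_S_smul.comp (tendsto_ofComplex_I_mul two_pos)
  refine h.congr' ?_
  filter_upwards [eventually_gt_atTop 0] with t ht
  have h1 : 0 < (((2 : ℝ) : ℂ) * (Complex.I * t)).im := by simpa using ht
  have e : ModularGroup.S • ofComplex (((2 : ℝ) : ℂ) * (Complex.I * t))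
      = ofComplex (-1 / (2 * (Complex.I * t))) := by
    have e1 := coe_S_smul (ofComplex (((2 : ℝ) : ℂ) * (Complex.I * t)))
    rw [ofComplex_apply_of_im_pos h1, coe_mk] at e1
    rw [ofComplex_apply_of_im_pos h1, ← ofComplex_apply (ModularGroup.S • _), e1]
    push_cast; rfl
  simp only [Function.comp_apply, e]

/-! ### The homeomorphism of the compactified modular curve with `ℙ(1, 2)` -/

/-- The Hauptmodul as a function on `ℍ / Γ₀(2)`. -/
def hauptmodulOrbit : OpenCurve → ℂ :=
  Quotient.lift hauptmodul fun σ τ h => by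
    obtain ⟨γ, hγ, rfl⟩ := orbit_eq_iff.1 (Quotient.sound h : orbit σ = orbit τ)
    exact hauptmodul_smul hγ τ

lemma exists_orbit (p : OpenCurve) : ∃ τ, p = orbit τ := by
  induction p using Quotient.inductionOn with
  | h τ => exact ⟨τ, rfl⟩

/-- The map from the compactified modular curve to `ℙ(1, 2)` given by `[h₁ : h₂]`. -/
def toWProj : ModularCurve → WProj 1 2
  | .ofOrbit p => lineInfty (hauptmodulOrbit p)
  | .zero => mk 1 2 (8, 1) (by simp)
  | .infty => mk 1 2 (1, 0) (by simp)

lemma toWProj_proj (τ : ℍ) : toWProj (ModularCurve.proj τ) = lineInfty (hauptmodul τ) := rfl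

lemma proj_smul {γ : SL(2, ℤ)} (hγ : γ ∈ CongruenceSubgroup.Gamma0 2) (τ : ℍ) :
    ModularCurve.proj (γ • τ) = ModularCurve.proj τ :=
  congrArg ModularCurve.ofOrbit (orbit_eq_iff.2 ⟨γ, hγ, rfl⟩ : orbit (γ • τ) = orbit τ)

lemma continuous_proj : Continuous ModularCurve.proj :=
  continuous_def.2 fun _ hU => hU.1

lemma continuous_toWProj : Continuous toWProj := by
  refine continuous_def.2 fun U hU => ⟨?_, fun h => ?_, fun h => ?_⟩
  · exact hU.preimage (continuous_lineInfty.comp continuous_hauptmodul)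
  · have h0 : lineInfty 0 ∈ U := lineInfty_zero ▸ h
    have h1 := ((continuous_lineInfty.tendsto 0).comp tendsto_hauptmodul).eventually
      (hU.mem_nhds h0)
    obtain ⟨c, hc⟩ := atImInfty_mem _ |>.1 h1
    exact ⟨c, fun τ hτ => hc τ hτ.le⟩
  · have h0 : lineZero 0 ∈ U := lineZero_zero ▸ h
    obtain ⟨ε, hε, hball⟩ := Metric.mem_nhds_iff.1
      ((continuous_lineZero.tendsto 0).eventually (hU.mem_nhds h0))
    obtain ⟨c, hc⟩ := exists_lt_norm_hauptmodul ε⁻¹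
    refine ⟨c, fun τ hτ => ?_⟩
    rw [Set.mem_preimage, toWProj_proj, ← lineZero_inv (hauptmodul_ne_zero τ)]
    refine hball ?_
    rw [mem_ball_zero_iff, norm_inv]
    exact inv_lt_of_inv_lt₀ hε (hc τ hτ)

/-- The members of a cover that contain the cusps swallow two horoballs; the rest is the image of a
compact subset of `ℍ`. -/
instance : CompactSpace ModularCurve := by
  refine ⟨isCompact_of_finite_subcover fun {ι} U hU hcov => ?_⟩
  classical
  obtain ⟨i, hi⟩ := Set.mem_iUnion.1 (hcov (Set.mem_univ ModularCurve.infty))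
  obtain ⟨j, hj⟩ := Set.mem_iUnion.1 (hcov (Set.mem_univ ModularCurve.zero))
  obtain ⟨c, hc⟩ := (hU i).2.1 hi
  obtain ⟨d, hd⟩ := (hU j).2.2 hj
  obtain ⟨K, hK, h⟩ := exists_compact_representatives (max c d)
  obtain ⟨t, ht⟩ := (hK.image continuous_proj).elim_finite_subcover U hU
    ((Set.subset_univ _).trans hcov)
  refine ⟨insert i (insert j t), fun p _ => ?_⟩
  simp only [Finset.mem_insert, Set.iUnion_iUnion_eq_or_left, Set.mem_union]
  rcases p with p | _ | _
  · obtain ⟨τ, rfl⟩ := exists_orbit p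
    change ModularCurve.proj τ ∈ _ ∨ ModularCurve.proj τ ∈ _ ∨ ModularCurve.proj τ ∈ _
    obtain ⟨γ, hγ, h | h | h⟩ := h τ
    · exact .inr (.inr (proj_smul hγ τ ▸ ht ⟨_, h, rfl⟩))
    · exact .inl (proj_smul hγ τ ▸ hc _ ((le_max_left _ _).trans_lt h))
    · exact .inr (.inl (proj_smul hγ τ ▸ hd _ ((le_max_right _ _).trans_lt h)))
  · exact .inr (.inl hj)
  · exact .inl hi

lemma hauptmodulOrbit_ne_zero (p : OpenCurve) : hauptmodulOrbit p ≠ 0 := by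
  obtain ⟨τ, rfl⟩ := exists_orbit p
  exact hauptmodul_ne_zero τ

lemma hauptmodulOrbit_injective : Function.Injective hauptmodulOrbit := by
  intro p q h
  obtain ⟨σ, rfl⟩ := exists_orbit p
  obtain ⟨τ, rfl⟩ := exists_orbit q
  exact orbit_eq_of_hauptmodul_eq h

lemma toWProj_injective : Function.Injective toWProj := by
  have h0 (p : OpenCurve) : lineInfty (hauptmodulOrbit p) ≠ mk 1 2 (1, 0) (by simp) := by
    rw [← lineInfty_zero]
    exact fun h => hauptmodulOrbit_ne_zero p (lineInfty_injective h)
  have h1 : mk 1 2 (8, 1) (by simp) ≠ mk 1 2 (1, 0) (by simp) := by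
    rw [← lineInfty_zero]
    exact (lineInfty_ne 0).symm
  rintro (p | _ | _) (q | _ | _) h
  · exact congrArg _ (hauptmodulOrbit_injective (lineInfty_injective h))
  · exact absurd h (lineInfty_ne _)
  · exact absurd h (h0 p)
  · exact absurd h.symm (lineInfty_ne _)
  · rfl
  · exact absurd h h1
  · exact absurd h.symm (h0 q)
  · exact absurd h.symm h1
  · rfl

lemma toWProj_surjective : Function.Surjective toWProj := by
  intro p
  obtain ⟨v, hv, rfl⟩ := exists_mk p
  by_cases hD : v.1 ^ 2 - 64 * v.2 = 0
  · refine ⟨.zero, ?_⟩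
    rw [toWProj, mk_one_two_eq_iff]
    linear_combination -hD
  rw [mk_eq_lineInfty hD]
  by_cases hw : v.2 / (v.1 ^ 2 - 64 * v.2) = 0
  · exact ⟨.infty, by rw [hw, lineInfty_zero]; rfl⟩
  · obtain ⟨τ, hτ⟩ := exists_hauptmodul_eq hw
    exact ⟨ModularCurve.proj τ, by rw [toWProj_proj, hτ]⟩

/-- The homeomorphism `ℍ / Γ₀(2) ∪ {0, ∞} ≅ ℙ(1, 2)` given by `[h₁ : h₂]`. -/
def homeoWProj : ModularCurve ≃ₜ WProj 1 2 :=
  Continuous.homeoOfEquivCompactToT2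
    (f := Equiv.ofBijective toWProj ⟨toWProj_injective, toWProj_surjective⟩) continuous_toWProj

/-! ### Holomorphic functions -/

lemma pullback_eq {a b : ℕ} (f : WProj a b → ℂ) {v : ℂ × ℂ} (hv : v ≠ 0) :
    pullback f v = f (mk a b v hv) := dif_pos hv

lemma continuousOn_of_holomorphicOn {a b : ℕ} {U : Set (WProj a b)} (hU : IsOpen U)
    {f : WProj a b → ℂ} (h : WProj.HolomorphicOn U f) : ContinuousOn f U := by
  refine (continuousOn_open_iff hU).2 fun t ht => ?_
  have hd : DifferentiableOn ℂ (pullback f) {v | ∃ hv : v ≠ 0, mk a b v hv ∈ U} := h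
  have h1 := (hd.continuousOn.isOpen_inter_preimage (isOpen_preimage_mk hU) ht).preimage
    (continuous_subtype_val (p := fun v : ℂ × ℂ => v ≠ 0))
  refine isQuotientMap_quotient_mk'.isOpen_preimage.1 ?_
  convert h1 using 1
  ext v
  constructor
  · rintro ⟨h2, h3⟩
    exact ⟨⟨v.2, h2⟩, by rw [Set.mem_preimage, pullback_eq f v.2]; exact h3⟩
  · rintro ⟨⟨hv, h2⟩, h3⟩
    rw [Set.mem_preimage, pullback_eq f v.2] at h3
    exact ⟨h2, h3⟩

/-- Cauchy's formula tolerates a countable exceptional set at which only continuity is known. The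
critical values can thus be ignored without analysing ramification. -/
lemma differentiableOn_of_off_countable {f : ℂ → ℂ} {N s : Set ℂ} (hN : IsOpen N)
    (hs : s.Countable) (hc : ContinuousOn f N) (hd : ∀ z ∈ N \ s, DifferentiableAt ℂ f z) :
    DifferentiableOn ℂ f N := by
  intro z hz
  obtain ⟨r, hr, hball⟩ := Metric.nhds_basis_closedBall.mem_iff.1 (hN.mem_nhds hz)
  lift r to NNReal using hr.le
  exact (hasFPowerSeriesOnBall_of_differentiable_off_countable hs (hc.mono hball)
    (fun w hw => hd w ⟨hball (Metric.ball_subset_closedBall hw.1), hw.2⟩)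
    hr).analyticAt.differentiableAt.differentiableWithinAt

lemma differentiableAt_comp_lineInfty {f : WProj 1 2 → ℂ} {τ : ℍ}
    (hτ : hauptmodul τ ∉ criticalValues)
    (hf : MDifferentiableAt 𝓘(ℂ) 𝓘(ℂ) (fun τ : ℍ => f (lineInfty (hauptmodul τ))) τ) :
    DifferentiableAt ℂ (f ∘ lineInfty) (hauptmodul τ) := by
  obtain ⟨d, hd, h⟩ := exists_local_inverse hτ
  have hval : (hauptmodul ∘ ofComplex) τ = hauptmodul τ := by simp
  have hinv := h.to_localInverse hd
  rw [hval] at hinv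
  have hright : ∀ᶠ z in 𝓝 (hauptmodul τ),
      (hauptmodul ∘ ofComplex) (h.localInverse _ _ _ hd z) = z := by
    have := (h.hasStrictFDerivAt_equiv hd).eventually_right_inverse
    rwa [hval] at this
  have hpt : h.localInverse _ _ _ hd (hauptmodul τ) = τ := by
    have := (h.hasStrictFDerivAt_equiv hd).localInverse_apply_image
    rwa [hval] at this
  have hf' := UpperHalfPlane.mdifferentiableAt_iff.1 hf
  rw [← hpt] at hf'
  refine (hf'.comp _ hinv.hasDerivAt.differentiableAt).congr_of_eventuallyEq ?_
  filter_upwards [hright] with z hz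
  simp only [Function.comp_apply] at hz ⊢
  rw [hz]

lemma holomorphicOn_iff {U : Set (WProj 1 2)} (hU : IsOpen U) (f : WProj 1 2 → ℂ) :
    WProj.HolomorphicOn U f ↔
      ModularCurve.HolomorphicOn (homeoWProj ⁻¹' U) (f ∘ homeoWProj) := by
  have hmk (τ : ℍ) : homeoWProj (ModularCurve.proj τ) = mk 1 2 (h₁ τ, h₂ τ) (h_ne_zero τ) :=
    (mk_h_eq_lineInfty τ).symm
  constructor
  · intro h
    refine ⟨(continuousOn_of_holomorphicOn hU h).comp homeoWProj.continuous.continuousOn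
      (Set.mapsTo_preimage _ _), fun τ hτ => MDifferentiableAt.mdifferentiableWithinAt ?_⟩
    have hτ' : mk 1 2 (h₁ τ, h₂ τ) (h_ne_zero τ) ∈ U := hmk τ ▸ hτ
    have e : (fun τ => (f ∘ homeoWProj) (ModularCurve.proj τ))
        = fun τ => pullback f (h₁ τ, h₂ τ) := by
      ext σ
      rw [pullback_eq f (h_ne_zero σ), Function.comp_apply, hmk]
    rw [e, UpperHalfPlane.mdifferentiableAt_iff]
    have hp := h.differentiableAt ((isOpen_preimage_mk hU).mem_nhds ⟨h_ne_zero τ, hτ'⟩)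
    have h1 := UpperHalfPlane.mdifferentiableAt_iff.1 (mdifferentiable_h₁ τ)
    have h2 := UpperHalfPlane.mdifferentiableAt_iff.1 (mdifferentiable_h₂ τ)
    have hp' : DifferentiableAt ℂ (pullback f) (((h₁ ∘ ofComplex) τ, (h₂ ∘ ofComplex) τ)) := by
      simpa using hp
    exact DifferentiableAt.comp (g := pullback f) (τ : ℂ) hp' (h1.prodMk h2)
  · rintro ⟨hc, hd⟩
    have hcf : ContinuousOn f U := by
      have := hc.comp (s := U) homeoWProj.symm.continuous.continuousOn
        (fun p hp => by simpa using hp)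
      refine this.congr fun p _ => by simp
    have hN : IsOpen (lineInfty ⁻¹' U) := hU.preimage continuous_lineInfty
    have hM : IsOpen (lineZero ⁻¹' U) := hU.preimage continuous_lineZero
    have hV : IsOpen {τ : ℍ | ModularCurve.proj τ ∈ homeoWProj ⁻¹' U} :=
      (hU.preimage homeoWProj.continuous).preimage continuous_proj
    have hG : DifferentiableOn ℂ (f ∘ lineInfty) (lineInfty ⁻¹' U) := by
      -- In the coordinate `w`, the function is continuous throughout, and holomorphic off `0` and
      -- the critical values by inverting the Hauptmodul locally.
      refine differentiableOn_of_off_countable hN (countable_criticalValues.insert 0)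
        (hcf.comp continuous_lineInfty.continuousOn (Set.mapsTo_preimage _ _)) ?_
      rintro w ⟨hw, hw'⟩
      rw [Set.mem_insert_iff, not_or] at hw'
      obtain ⟨τ, rfl⟩ := exists_hauptmodul_eq hw'.1
      exact differentiableAt_comp_lineInfty hw'.2 ((hd τ hw).mdifferentiableAt (hV.mem_nhds hw))
    have hG₀ : DifferentiableOn ℂ (f ∘ lineZero) (lineZero ⁻¹' U) := by
      -- The chart at `[8 : 1]` meets the other one through `w ↦ w⁻¹`, leaving only the point `0` to
      -- be removed.
      refine differentiableOn_of_off_countable hM (Set.countable_singleton 0)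
        (hcf.comp continuous_lineZero.continuousOn (Set.mapsTo_preimage _ _)) ?_
      rintro w ⟨hw, hw0 : w ≠ 0⟩
      have hw' : w⁻¹ ∈ lineInfty ⁻¹' U := by
        rw [Set.mem_preimage, ← lineZero_inv (inv_ne_zero hw0), inv_inv]; exact hw
      refine ((hG.differentiableAt (hN.mem_nhds hw')).comp w
        (differentiableAt_inv hw0)).congr_of_eventuallyEq ?_
      filter_upwards [isOpen_ne.mem_nhds hw0] with z hz
      rw [Function.comp_apply, Function.comp_apply, Function.comp_apply,
        ← lineZero_inv (inv_ne_zero hz), inv_inv]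
    rintro v ⟨hv, hvU⟩
    refine DifferentiableAt.differentiableWithinAt ?_
    by_cases hD : v.1 ^ 2 - 64 * v.2 = 0
    · have hv2 : v.2 ≠ 0 := fun h2 => hv (Prod.ext (by simpa [h2] using hD) h2)
      have hmem : (v.1 ^ 2 - 64 * v.2) / v.2 ∈ lineZero ⁻¹' U := by
        rw [Set.mem_preimage, ← mk_eq_lineZero (hv := hv) hv2]; exact hvU
      have hdiff : DifferentiableAt ℂ (fun v : ℂ × ℂ => (v.1 ^ 2 - 64 * v.2) / v.2) v := by
        fun_prop (disch := exact hv2)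
      refine ((hG₀.differentiableAt (hM.mem_nhds hmem)).comp v hdiff).congr_of_eventuallyEq ?_
      filter_upwards [(isOpen_ne.preimage continuous_snd).mem_nhds hv2] with z (hz : z.2 ≠ 0)
      have hz0 : z ≠ 0 := fun h => hz (by rw [h]; rfl)
      rw [pullback_eq f hz0, mk_eq_lineZero hz]; rfl
    · have hmem : v.2 / (v.1 ^ 2 - 64 * v.2) ∈ lineInfty ⁻¹' U := by
        rw [Set.mem_preimage, ← mk_eq_lineInfty (hv := hv) hD]; exact hvU
      have hdiff : DifferentiableAt ℂ (fun v : ℂ × ℂ => v.2 / (v.1 ^ 2 - 64 * v.2)) v := by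
        fun_prop (disch := exact hD)
      refine ((hG.differentiableAt (hN.mem_nhds hmem)).comp v hdiff).congr_of_eventuallyEq ?_
      have hcont : Continuous fun v : ℂ × ℂ => v.1 ^ 2 - 64 * v.2 := by fun_prop
      filter_upwards [(isOpen_ne.preimage hcont).mem_nhds hD] with z (hz : z.1 ^ 2 - 64 * z.2 ≠ 0)
      have hz0 : z ≠ 0 := fun h => hz (by rw [h]; simp)
      rw [pullback_eq f hz0, mk_eq_lineInfty hz]; rfl

/-! ### Invariants of lattices -/

/-- The periods `ω` and `2τω`. -/
def periodPair (τ : ℍ) {ω : ℂ} (hω : ω ≠ 0) : PeriodPair where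
  ω₁ := ω
  ω₂ := 2 * (τ : ℂ) * ω
  indep := by
    rw [LinearIndependent.pair_iff]
    intro s t h
    have h1 : (s : ℂ) + t * (2 * τ) = 0 := by
      apply mul_right_cancel₀ hω
      simp only [real_smul] at h
      linear_combination h
    have ht : t = 0 := by
      have := congrArg Complex.im h1
      simpa [τ.im_ne_zero] using this
    subst ht
    simpa using h1

/-- The lattice is `ω(ℤ + ℤ·2τ)`, so its sum is `ω⁻ᵏ` times the full Eisenstein sum at `2τ`. The
coordinates are swapped because `eisSummand` puts the coefficient of `2τ` first. -/
lemma G_periodPair (τ : ℍ) {ω : ℂ} (hω : ω ≠ 0) {k : ℕ} (hk : 3 ≤ k) :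
    (periodPair τ hω).G k = (ω ^ k)⁻¹ * (2 * riemannZeta k * E hk (twice τ)) := by
  have hE : 2 * riemannZeta k * E hk (twice τ)
      = ∑' v : Fin 2 → ℤ, EisensteinSeries.eisSummand k v (twice τ) := by
    rw [tsum_eisSummand_eq_riemannZeta_mul_eisensteinSeries hk]
    have : E hk (twice τ) = 1 / 2 * eisensteinSeries (N := 1) 0 k (twice τ) := rfl
    rw [this]; ring
  rw [hE, PeriodPair.G, ← (periodPair τ hω).latticeEquivProd.symm.toEquiv.tsum_eq, ← tsum_mul_left,
    ← ((finTwoArrowEquiv ℤ).trans (Equiv.prodComm ℤ ℤ)).tsum_eq]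
  refine tsum_congr fun v => ?_
  have h := (periodPair τ hω).latticeEquiv_symm_apply
    (((finTwoArrowEquiv ℤ).trans (Equiv.prodComm ℤ ℤ)) v)
  have h' : (((periodPair τ hω).latticeEquivProd.symm.toEquiv
      (((finTwoArrowEquiv ℤ).trans (Equiv.prodComm ℤ ℤ)) v) : (periodPair τ hω).lattice) : ℂ)
      = ω * (v 0 * (twice τ : ℂ) + v 1) := by
    refine h.trans ?_
    change (v 1 : ℂ) * ω + (v 0 : ℂ) * (2 * τ * ω) = ω * (v 0 * (2 * τ) + v 1)
    ring
  rw [h', mul_pow, mul_inv, EisensteinSeries.eisSummand, zpow_neg, zpow_natCast]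

lemma riemannZeta_six : riemannZeta 6 = π ^ 6 / 945 := by
  have h := riemannZeta_two_mul_nat (k := 3) (by norm_num)
  have hb : bernoulli 6 = 1 / 42 := by decide +kernel
  norm_num [hb, Nat.factorial] at h
  rw [h]; ring

lemma g₂_periodPair (τ : ℍ) {ω : ℂ} (hω : ω ≠ 0) :
    (periodPair τ hω).g₂ = (ω ^ 4)⁻¹ * (4 * π ^ 4 / 3 * E₄ (twice τ)) := by
  rw [PeriodPair.g₂, G_periodPair τ hω (by norm_num : 3 ≤ 4)]
  have := riemannZeta_four
  push_cast
  rw [this]; ring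

lemma g₃_periodPair (τ : ℍ) {ω : ℂ} (hω : ω ≠ 0) :
    (periodPair τ hω).g₃ = (ω ^ 6)⁻¹ * (8 * π ^ 6 / 27 * E₆ (twice τ)) := by
  rw [PeriodPair.g₃, G_periodPair τ hω (by norm_num : 3 ≤ 6)]
  have := riemannZeta_six
  push_cast
  rw [this]; ring

/-! ### The curves `E(u)` -/

lemma g₂_eq (u₁ u₂ : ℂ) :
    g₂ u₁ u₂ = ((1 - 4 * u₁ - 4 * u₂) ^ 2 - 48 * (u₁ * u₂)) / 192 := by
  rw [g₂, quarticG₂]; ring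

lemma g₃_eq (u₁ u₂ : ℂ) : g₃ u₁ u₂ =
    -((1 - 4 * u₁ - 4 * u₂) * ((1 - 4 * u₁ - 4 * u₂) ^ 2 - 72 * (u₁ * u₂))) / 13824 := by
  rw [g₃, quarticG₃, Matrix.det_fin_three]; simp; ring

lemma discE_eq (u₁ u₂ : ℂ) : discE u₁ u₂ =
    (u₁ * u₂) ^ 2 * ((1 - 4 * u₁ - 4 * u₂) ^ 2 - 64 * (u₁ * u₂)) / 4096 := by
  rw [discE, g₂_eq, g₃_eq]; ring

lemma exists_mk_h_eq {v : ℂ × ℂ} {hv : v ≠ 0} (h2 : v.2 ≠ 0) (hD : v.1 ^ 2 - 64 * v.2 ≠ 0) :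
    ∃ τ : ℍ, mk 1 2 (h₁ τ, h₂ τ) (h_ne_zero τ) = mk 1 2 v hv := by
  obtain ⟨τ, hτ⟩ := exists_hauptmodul_eq (div_ne_zero h2 hD)
  exact ⟨τ, by rw [mk_h_eq_lineInfty, hτ, mk_eq_lineInfty hD]⟩

lemma exists_periodPair {u₁ u₂ : ℂ} {hu : (1 - 4 * u₁ - 4 * u₂, u₁ * u₂) ≠ (0 : ℂ × ℂ)} {τ : ℍ}
    (h : mk 1 2 (h₁ τ, h₂ τ) (h_ne_zero τ) = mk 1 2 _ hu) :
    ∃ L : PeriodPair, L.ω₂ = 2 * (τ : ℂ) * L.ω₁ ∧ L.g₂ = g₂ u₁ u₂ ∧ L.g₃ = g₃ u₁ u₂ := by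
  obtain ⟨l, hl⟩ := mk_eq_iff.1 h
  have hp : 1 - 4 * u₁ - 4 * u₂ = l ^ 1 * h₁ τ := congrArg Prod.fst hl
  have hq : u₁ * u₂ = l ^ 2 * h₂ τ := congrArg Prod.snd hl
  -- Here `x = ω⁻¹`. Matching `g₂` requires `(2π²x²)² = l²`, and matching `g₃` requires `(2π²x²)³ =
  -- -l³`, so `2π²x² = -l`.
  obtain ⟨x, hx⟩ := IsAlgClosed.exists_pow_nat_eq (-(l : ℂ) / (2 * π ^ 2)) two_pos
  have hpi : (π : ℂ) ≠ 0 := ofReal_ne_zero.2 Real.pi_ne_zero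
  have hx0 : x ≠ 0 := by
    rintro rfl
    rw [zero_pow two_ne_zero, eq_comm, div_eq_zero_iff] at hx
    simp [hpi] at hx
  have hx2 : x ^ 2 * (2 * π ^ 2) = -l := by
    rw [hx, div_mul_cancel₀]
    exact mul_ne_zero two_ne_zero (pow_ne_zero 2 hpi)
  refine ⟨periodPair τ (inv_ne_zero hx0), rfl, ?_, ?_⟩
  · rw [g₂_periodPair, g₂_eq, hp, hq, inv_pow, inv_inv]
    have e : (x ^ 2 * (2 * π ^ 2)) ^ 2 = (-(l : ℂ)) ^ 2 := by rw [hx2]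
    linear_combination E₄ (twice τ) / 3 * e - l ^ 2 / 192 * h_eq_E₄ τ
  · rw [g₃_periodPair, g₃_eq, hp, hq, inv_pow, inv_inv]
    have e : (x ^ 2 * (2 * π ^ 2)) ^ 3 = (-(l : ℂ)) ^ 3 := by rw [hx2]
    linear_combination E₆ (twice τ) / 27 * e + l ^ 3 / 13824 * h_eq_E₆ τ

/-- The parameters are the roots of the quadratic with root sum `(1 - p)/4` and root product `q`. -/
lemma exists_parameters (p q : ℂ) : ∃ u₁ u₂ : ℂ, 1 - 4 * u₁ - 4 * u₂ = p ∧ u₁ * u₂ = q := by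
  obtain ⟨r, hr⟩ := IsAlgClosed.exists_pow_nat_eq (((1 - p) / 4) ^ 2 - 4 * q) two_pos
  exact ⟨((1 - p) / 4 + r) / 2, ((1 - p) / 4 - r) / 2, by ring, by linear_combination -hr / 4⟩

lemma eta_two_mul_pow (τ : ℍ) : ModularForm.eta (2 * (τ : ℂ)) ^ 24 = discriminant (twice τ) := by
  simp only [discriminant, twice]

lemma hauptmodul_eq_eta (τ : ℍ) : h₂ τ / (h₁ τ ^ 2 - 64 * h₂ τ)
    = ModularForm.eta (2 * (τ : ℂ)) ^ 24 / ModularForm.eta (τ : ℂ) ^ 24 := by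
  rw [eta_two_mul_pow]; exact hauptmodul_eq τ

end ThetaLevelTwo

end

theorem lemma4p4 :
    -- `h₁` and `h₂` are modular forms of weight 2 and 4 for `Γ₀(2)`
    ((∃ F : ModularForm (CongruenceSubgroup.Gamma0 2 : Subgroup (GL (Fin 2) ℝ)) 2,
        (F : ℍ → ℂ) = ThetaLevelTwo.h₁) ∧
      (∃ F : ModularForm (CongruenceSubgroup.Gamma0 2 : Subgroup (GL (Fin 2) ℝ)) 4,
        (F : ℍ → ℂ) = ThetaLevelTwo.h₂)) ∧
    -- the relation with `E₄(2τ)`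
    (∀ τ : ℍ,
      ThetaLevelTwo.h₁ τ ^ 2 - 48 * ThetaLevelTwo.h₂ τ
          = 64 * ModularForm.E₄ (ThetaLevelTwo.twice τ) ∧
      Summable (fun n : ℕ+ =>
        (ArithmeticFunction.sigma 3 (n : ℕ) : ℂ) * ThetaLevelTwo.nome τ ^ (2 * (n : ℕ))) ∧
      ThetaLevelTwo.h₁ τ ^ 2 - 48 * ThetaLevelTwo.h₂ τ
          = 64 * (1 + 240 * ∑' n : ℕ+,
            (ArithmeticFunction.sigma 3 (n : ℕ) : ℂ) * ThetaLevelTwo.nome τ ^ (2 * (n : ℕ)))) ∧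
    -- the relation with `E₆(2τ)`
    (∀ τ : ℍ,
      ThetaLevelTwo.h₁ τ * (ThetaLevelTwo.h₁ τ ^ 2 - 72 * ThetaLevelTwo.h₂ τ)
          = 512 * ModularForm.E₆ (ThetaLevelTwo.twice τ) ∧
      Summable (fun n : ℕ+ =>
        (ArithmeticFunction.sigma 5 (n : ℕ) : ℂ) * ThetaLevelTwo.nome τ ^ (2 * (n : ℕ))) ∧
      ThetaLevelTwo.h₁ τ * (ThetaLevelTwo.h₁ τ ^ 2 - 72 * ThetaLevelTwo.h₂ τ)
          = 512 * (1 - 504 * ∑' n : ℕ+,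
            (ArithmeticFunction.sigma 5 (n : ℕ) : ℂ) * ThetaLevelTwo.nome τ ^ (2 * (n : ℕ)))) ∧
    -- the relations with the 24th power of the Dedekind eta function
    (∀ τ : ℍ,
      ThetaLevelTwo.h₂ τ ^ 2 * (ThetaLevelTwo.h₁ τ ^ 2 - 64 * ThetaLevelTwo.h₂ τ)
          = 2 ^ 18 * ModularForm.eta (2 * (τ : ℂ)) ^ 24 ∧
      Multipliable (fun n : ℕ+ => (1 - ThetaLevelTwo.nome τ ^ (2 * (n : ℕ))) ^ 24) ∧
      ThetaLevelTwo.h₂ τ ^ 2 * (ThetaLevelTwo.h₁ τ ^ 2 - 64 * ThetaLevelTwo.h₂ τ)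
          = 2 ^ 18 * ThetaLevelTwo.nome τ ^ 2 *
            ∏' n : ℕ+, (1 - ThetaLevelTwo.nome τ ^ (2 * (n : ℕ))) ^ 24 ∧
      ThetaLevelTwo.h₁ τ ^ 2 - 64 * ThetaLevelTwo.h₂ τ ≠ 0 ∧
      ModularForm.eta (τ : ℂ) ≠ 0 ∧
      ThetaLevelTwo.h₂ τ / (ThetaLevelTwo.h₁ τ ^ 2 - 64 * ThetaLevelTwo.h₂ τ)
          = ModularForm.eta (2 * (τ : ℂ)) ^ 24 / ModularForm.eta (τ : ℂ) ^ 24) ∧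
    -- `[h₁(τ) : h₂(τ)]` is a point of the weighted projective line for every `τ`
    ∃ hne : ∀ τ : ℍ, (ThetaLevelTwo.h₁ τ, ThetaLevelTwo.h₂ τ) ≠ (0 : ℂ × ℂ),
      -- the limits at the cusps `∞` and `0`, in `ℙ(2, 4)`
      Filter.Tendsto
        (fun t : ℝ => ThetaLevelTwo.WProj.mk 2 4 _ (hne (ofComplex (Complex.I * t))))
        Filter.atTop (nhds (ThetaLevelTwo.WProj.mk 2 4 (1, 0) (by simp))) ∧
      Filter.Tendsto
        (fun t : ℝ => ThetaLevelTwo.WProj.mk 2 4 _ (hne (ofComplex (-1 / (2 * (Complex.I * t))))))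
        Filter.atTop (nhds (ThetaLevelTwo.WProj.mk 2 4 (8, 1) (by simp))) ∧
      -- `τ ↦ [h₁(τ) : h₂(τ)]` induces an isomorphism `ℍ / Γ₀(2) ∪ {0, ∞} ≅ ℙ(1, 2)`
      (∃ Φ : ThetaLevelTwo.ModularCurve ≃ₜ ThetaLevelTwo.WProj 1 2,
        (∀ τ : ℍ, Φ (ThetaLevelTwo.ModularCurve.proj τ)
          = ThetaLevelTwo.WProj.mk 1 2 (ThetaLevelTwo.h₁ τ, ThetaLevelTwo.h₂ τ) (hne τ)) ∧
        Φ ThetaLevelTwo.ModularCurve.infty = ThetaLevelTwo.WProj.mk 1 2 (1, 0) (by simp) ∧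
        Φ ThetaLevelTwo.ModularCurve.zero = ThetaLevelTwo.WProj.mk 1 2 (8, 1) (by simp) ∧
        ∀ U : Set (ThetaLevelTwo.WProj 1 2), IsOpen U → ∀ f : ThetaLevelTwo.WProj 1 2 → ℂ,
          (ThetaLevelTwo.WProj.HolomorphicOn U f ↔
            ThetaLevelTwo.ModularCurve.HolomorphicOn (Φ ⁻¹' U) (f ∘ Φ))) ∧
      -- `[h₁(τ) : h₂(τ)] = [1 - 4u₁ - 4u₂ : u₁u₂]` for the smooth curves `E(u)`, and then
      -- `E(u)` has the period lattice `ℤω + ℤ(2τω)` for some `ω ≠ 0`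
      (∀ u₁ u₂ : ℂ, ThetaLevelTwo.discE u₁ u₂ ≠ 0 →
        ∃ hu : (1 - 4 * u₁ - 4 * u₂, u₁ * u₂) ≠ (0 : ℂ × ℂ),
          (∃ τ : ℍ, ThetaLevelTwo.WProj.mk 1 2 _ (hne τ) = ThetaLevelTwo.WProj.mk 1 2 _ hu) ∧
          ∀ τ : ℍ, ThetaLevelTwo.WProj.mk 1 2 _ (hne τ) = ThetaLevelTwo.WProj.mk 1 2 _ hu →
            ∃ L : PeriodPair, L.ω₂ = 2 * (τ : ℂ) * L.ω₁ ∧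
              L.g₂ = ThetaLevelTwo.g₂ u₁ u₂ ∧ L.g₃ = ThetaLevelTwo.g₃ u₁ u₂) ∧
      (∀ τ : ℍ, ∃ u₁ u₂ : ℂ, ThetaLevelTwo.discE u₁ u₂ ≠ 0 ∧
        ∃ hu : (1 - 4 * u₁ - 4 * u₂, u₁ * u₂) ≠ (0 : ℂ × ℂ),
          ThetaLevelTwo.WProj.mk 1 2 _ (hne τ) = ThetaLevelTwo.WProj.mk 1 2 _ hu) := by
  refine ⟨⟨ThetaLevelTwo.exists_modularForm_h₁, ThetaLevelTwo.exists_modularForm_h₂⟩,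
    fun τ => ?_, fun τ => ?_, fun τ => ?_, ThetaLevelTwo.h_ne_zero,
    ThetaLevelTwo.tendsto_mk_h_cusp_infty, ThetaLevelTwo.tendsto_mk_h_cusp_zero,
    ⟨ThetaLevelTwo.homeoWProj, fun τ => (ThetaLevelTwo.mk_h_eq_lineInfty τ).symm, rfl, rfl,
      fun U hU f => ThetaLevelTwo.holomorphicOn_iff hU f⟩, fun u₁ u₂ hu => ?_, fun τ => ?_⟩
  · refine ⟨ThetaLevelTwo.h_eq_E₄ τ,
      ThetaLevelTwo.summable_sigma_nome (k := 4) (by norm_num) τ, ?_⟩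
    rw [ThetaLevelTwo.h_eq_E₄, ThetaLevelTwo.E₄_twice_eq_tsum]
  · refine ⟨ThetaLevelTwo.h_eq_E₆ τ,
      ThetaLevelTwo.summable_sigma_nome (k := 6) (by norm_num) τ, ?_⟩
    rw [ThetaLevelTwo.h_eq_E₆, ThetaLevelTwo.E₆_twice_eq_tsum]
  · refine ⟨?_, ThetaLevelTwo.multipliable_nome τ, ?_,
      ThetaLevelTwo.h₁_sq_sub_ne_zero τ, ModularForm.eta_ne_zero τ.im_pos,
      ThetaLevelTwo.hauptmodul_eq_eta τ⟩
    · rw [ThetaLevelTwo.eta_two_mul_pow, ThetaLevelTwo.h_eq_discriminant_twice]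
    rw [ThetaLevelTwo.h_eq_discriminant_twice, ThetaLevelTwo.discriminant_twice_eq_tprod, mul_assoc]
  · rw [ThetaLevelTwo.discE_eq, ne_eq, div_eq_zero_iff, mul_eq_zero, not_or, not_or] at hu
    have h2 : u₁ * u₂ ≠ 0 := fun h => hu.1.1 (by rw [h, zero_pow two_ne_zero])
    exact ⟨fun h => h2 (congrArg Prod.snd h), ThetaLevelTwo.exists_mk_h_eq h2 hu.1.2,
      fun τ h => ThetaLevelTwo.exists_periodPair h⟩
  · obtain ⟨u₁, u₂, hp, hq⟩ := ThetaLevelTwo.exists_parameters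
      (ThetaLevelTwo.h₁ τ) (ThetaLevelTwo.h₂ τ)
    refine ⟨u₁, u₂, ?_, ?_, ?_⟩
    · rw [ThetaLevelTwo.discE_eq, hp, hq]
      exact div_ne_zero (mul_ne_zero (pow_ne_zero 2 (ThetaLevelTwo.h₂_ne_zero τ))
        (ThetaLevelTwo.h₁_sq_sub_ne_zero τ)) (by norm_num)
    · rw [hp, hq]
      exact ThetaLevelTwo.h_ne_zero τ
    · simp only [hp, hq]
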